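/- All graphs are finite, simple and undirected. A *total cover* of a graph $G=(V,E)$ is a set $D\subseteq V\cup E$ such that every element of $(V\cup E)\setminus D$ is adjacent or incident to an element of $D$ (two distinct edges being adjacent if they share an endpoint). The minimum total cover problem asks for a total cover of smallest size. **Theorem.** (1) The minimum total cover problem admits a $2$-approximation algorithm: there is a polynomial-time algorithm (a program for a random access machine with addition and truncated subtraction, run on the number of vertices and the adjacency matrix of $G$, with a number of steps bounded by a fixed polynomial in $|V|$) that outputs, for every graph $G$, a total cover of $G$ of size at most $2|D|$ for every total cover $D$ of $G$. (2) Let $M$ be a maximum matching of a graph $G$, let $m=|M|$, let $t$ be the number of isolated vertices of $G$, and let $k$ be the number of *bad* vertices, i.e. vertices that are not involved in $M$ and are adjacent to both endpoints of some edge of $M$. Consider the following procedure, in which all choices are arbitrary. (a) Put all isolated vertices into $S$ and remove them from $G$. (b) As long as a bad vertex is left, select a remaining bad vertex $w$ and a remaining edge $uv\in M$ with $u$ and $v$ both adjacent to $w$; add $w$ and the edge $uv$ to $S$, and remove $w,u,v$ from the graph. (c) Let $G_1$ be the remaining graph and $M_1$ the set of edges of $M$ in it. Go through the edges $uv\in M_1$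 in an arbitrary order. If an endpoint of $uv$ is adjacent to a vertex of $G_1$ that is not involved in $M$ and that is neither in $S$ nor adjacent or incident to an element of the current $S$, add that endpoint to $S$; otherwise add the edge $uv$ to $S$. Then every partial run of the procedure can be completed, and every complete run yields a total cover $S$ of $G$ with $|S|=m+k+t$ and $|S|\le 2|D|$ for every total cover $D$ of $G$. -/

import Mathlib

/-! ### Total covers -/

namespace TotalCover

universe u

variable {V : Type u}

/-- Two elements of `V ∪ E` touch: adjacent vertices, a vertex and an edge incident with it,
or two distinct edges with a common endpoint. -/
def Touches (G : SimpleGraph V) : V ⊕ G.edgeSet → V ⊕ G.edgeSet → Prop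
  | .inl u, .inl v => G.Adj u v
  | .inl u, .inr e => u ∈ e.1
  | .inr e, .inl u => u ∈ e.1
  | .inr e, .inr f => e ≠ f ∧ ∃ v, v ∈ e.1 ∧ v ∈ f.1

/-- The element `x` is covered by `D`: it lies in `D` or touches an element of `D`. -/
def Covers (G : SimpleGraph V) (D : Set (V ⊕ G.edgeSet)) (x : V ⊕ G.edgeSet) : Prop :=
  x ∈ D ∨ ∃ y ∈ D, Touches G x y

/-- Every element of `(V ∪ E) \ D` is adjacent or incident to an element of `D`. -/
def IsTotalCover (G : SimpleGraph V) (D : Set (V ⊕ G.edgeSet)) : Prop :=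
  ∀ x, Covers G D x

/-- `M` is a matching with the largest possible number of edges. -/
def IsMaximumMatching (G : SimpleGraph V) (M : G.Subgraph) : Prop :=
  M.IsMatching ∧ ∀ M' : G.Subgraph, M'.IsMatching → M'.edgeSet.ncard ≤ M.edgeSet.ncard

/-- The set of isolated vertices. -/
def isolated (G : SimpleGraph V) : Set V := {v | G.IsIsolated v}

/-- The set of bad vertices: not involved in `M`, and adjacent to both ends of an edge of `M`. -/
def bad (G : SimpleGraph V) (M : G.Subgraph) : Set V :=
  {w | w ∉ M.verts ∧ ∃ u v, M.Adj u v ∧ G.Adj w u ∧ G.Adj w v}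

/-! ### The greedy procedure

In the configurations, `R` is the vertex set of what is left of the graph, `S` the part of the
cover built so far, and `Q` the set of matching edges still to be picked. -/

/-- Configurations of the greedy procedure: while bad vertices are being removed, and while the
remaining matching edges are being picked one after the other. -/
inductive Config (G : SimpleGraph V)
  | removing (R : Set V) (S : Set (V ⊕ G.edgeSet))
  | picking (R : Set V) (Q : Set (Sym2 V)) (S : Set (V ⊕ G.edgeSet))

/-- The isolated vertices are put into the cover and removed from the graph. -/
def Config.init (G : SimpleGraph V) : Config G :=
  .removing (isolated G)ᶜ (Sum.inl '' isolated G)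

/-- One step of the procedure; all choices are arbitrary. -/
inductive Step (G : SimpleGraph V) (M : G.Subgraph) : Config G → Config G → Prop
  /-- A bad vertex `w` that is still there, and a matching edge `uv` that is still there and both
  of whose ends are adjacent to `w`: put `w` and `uv` into the cover, remove `w`, `u`, `v`. -/
  | remove {R : Set V} {S : Set (V ⊕ G.edgeSet)} {w u v : V} (hw : w ∈ bad G M) (huv : M.Adj u v)
      (hwR : w ∈ R) (huR : u ∈ R) (hvR : v ∈ R) (hwu : G.Adj w u) (hwv : G.Adj w v) :
      Step G M (.removing R S)
        (.removing (R \ {w, u, v}) (S ∪ {.inl w, .inr ⟨s(u, v), M.adj_sub huv⟩}))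
  /-- When no bad vertex is left, go on with the matching edges of the remaining graph. -/
  | switch {R : Set V} {S : Set (V ⊕ G.edgeSet)} (h : ∀ w ∈ R, w ∉ bad G M) :
      Step G M (.removing R S) (.picking R {e | e ∈ M.edgeSet ∧ ∀ x ∈ e, x ∈ R} S)
  /-- The picked edge `uv` has an end `u` adjacent to a remaining unmatched vertex `z` that is not
  covered so far: put `u` into the cover. -/
  | pickVertex {R : Set V} {Q : Set (Sym2 V)} {S : Set (V ⊕ G.edgeSet)} {u v z : V}
      (huv : M.Adj u v) (hQ : s(u, v) ∈ Q) (hzR : z ∈ R) (hzM : z ∉ M.verts) (huz : G.Adj u z)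
      (hz : ¬ Covers G S (.inl z)) :
      Step G M (.picking R Q S) (.picking R (Q \ {s(u, v)}) (S ∪ {.inl u}))
  /-- Neither end of the picked edge `uv` is adjacent to such a vertex: put `uv` into the cover. -/
  | pickEdge {R : Set V} {Q : Set (Sym2 V)} {S : Set (V ⊕ G.edgeSet)} {u v : V}
      (huv : M.Adj u v) (hQ : s(u, v) ∈ Q)
      (h : ∀ z ∈ R, z ∉ M.verts → G.Adj u z ∨ G.Adj v z → Covers G S (.inl z)) :
      Step G M (.picking R Q S)
        (.picking R (Q \ {s(u, v)}) (S ∪ {.inr ⟨s(u, v), M.adj_sub huv⟩}))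

/-- The procedure, started on `G` with the matching `M`, can reach the configuration `c`. -/
def Reachable (G : SimpleGraph V) (M : G.Subgraph) (c : Config G) : Prop :=
  Relation.ReflTransGen (Step G M) (Config.init G) c

/-- The procedure is finished, with output `S`: no matching edge is left to be picked. -/
def Config.IsFinal {G : SimpleGraph V} (c : Config G) (S : Set (V ⊕ G.edgeSet)) : Prop :=
  ∃ R : Set V, c = .picking R ∅ S

end TotalCover

/-! ### A random access machine

Structured programs over natural number variables and (two-dimensional) arrays of natural numbers
with random access.  The only arithmetic operations are addition and truncated subtraction, so
that the bit length of all numbers grows at most by one per operation, and polynomial time on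
this machine is the same as polynomial time on a Turing machine. -/

namespace RAM

/-- The memory: the value of each variable, and the entries of each array. Variables and arrays
are named by natural numbers. -/
structure State where
  var : ℕ → ℕ
  arr : ℕ → ℕ → ℕ → ℕ

/-- Expressions; `read a i j` is the entry with indices `i`, `j` of the array named `a`. -/
inductive Expr
  | const (c : ℕ)
  | var (x : ℕ)
  | add (e f : Expr)
  | sub (e f : Expr)
  | read (a : ℕ) (i j : Expr)

/-- The value of an expression. -/
def Expr.eval (s : State) : Expr → ℕ
  | .const c => c
  | .var x => s.var x
  | .add e f => e.eval s + f.eval s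
  | .sub e f => e.eval s - f.eval s
  | .read a i j => s.arr a (i.eval s) (j.eval s)

/-- The number of operations needed to evaluate an expression. -/
def Expr.cost : Expr → ℕ
  | .const _ => 1
  | .var _ => 1
  | .add e f => e.cost + f.cost + 1
  | .sub e f => e.cost + f.cost + 1
  | .read _ i j => i.cost + j.cost + 1

/-- Programs. A condition counts as true if its value is not `0`. -/
inductive Prog
  | skip
  | assign (x : ℕ) (e : Expr)
  | store (a : ℕ) (i j e : Expr)
  | seq (p q : Prog)
  | ite (b : Expr) (p q : Prog)
  | loop (b : Expr) (p : Prog)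

/-- The state after the variable `x` has been set to `k`. -/
def State.setVar (s : State) (x k : ℕ) : State :=
  { s with var := fun y => if y = x then k else s.var y }

/-- The state after the entry `i`, `j` of the array `a` has been set to `k`. -/
def State.setArr (s : State) (a i j k : ℕ) : State :=
  { s with arr := fun a' i' j' => if a' = a ∧ i' = i ∧ j' = j then k else s.arr a' i' j' }

/-- `Runs p s k s'`: the program `p`, started in the state `s`, halts after exactly `k` steps, in
the state `s'`. -/
inductive Runs : Prog → State → ℕ → State → Prop
  | skip (s : State) : Runs .skip s 1 s
  | assign (x : ℕ) (e : Expr) (s : State) :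
      Runs (.assign x e) s (e.cost + 1) (s.setVar x (e.eval s))
  | store (a : ℕ) (i j e : Expr) (s : State) :
      Runs (.store a i j e) s (i.cost + j.cost + e.cost + 1)
        (s.setArr a (i.eval s) (j.eval s) (e.eval s))
  | seq {p q : Prog} {s s' s'' : State} {k l : ℕ} :
      Runs p s k s' → Runs q s' l s'' → Runs (.seq p q) s (k + l) s''
  | iteTrue {b : Expr} {p q : Prog} {s s' : State} {k : ℕ} :
      b.eval s ≠ 0 → Runs p s k s' → Runs (.ite b p q) s (b.cost + 1 + k) s'
  | iteFalse {b : Expr} {p q : Prog} {s s' : State} {k : ℕ} :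
      b.eval s = 0 → Runs q s k s' → Runs (.ite b p q) s (b.cost + 1 + k) s'
  | loopTrue {b : Expr} {p : Prog} {s s' s'' : State} {k l : ℕ} :
      b.eval s ≠ 0 → Runs p s k s' → Runs (.loop b p) s' l s'' →
      Runs (.loop b p) s (b.cost + 1 + k + l) s''
  | loopFalse {b : Expr} {p : Prog} {s : State} :
      b.eval s = 0 → Runs (.loop b p) s (b.cost + 1) s

/-- The input: variable `0` holds the number of vertices, array `0` the adjacency matrix, and
everything else is `0`. -/
noncomputable def input {n : ℕ} (G : SimpleGraph (Fin n)) : State where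
  var x := if x = 0 then n else 0
  arr a i j :=
    open Classical in
    if a = 0 ∧ ∃ (hi : i < n) (hj : j < n), G.Adj ⟨i, hi⟩ ⟨j, hj⟩ then 1 else 0

/-- The output, a set of vertices and edges of `G`: the vertices `v` with a nonzero entry `v`, `0`
in array `1`, and the edges `uv` with a nonzero entry `u`, `v` (or `v`, `u`) in array `2`. -/
def output {n : ℕ} (G : SimpleGraph (Fin n)) (s : State) : Set (Fin n ⊕ G.edgeSet) :=
  {x | match x with
    | .inl v => s.arr 1 v 0 ≠ 0
    | .inr e => ∃ u v : Fin n, e.1 = s(u, v) ∧ s.arr 2 u v ≠ 0}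

end RAM

namespace TotalCover

/-- The program `p` is a polynomial-time `ρ`-approximation algorithm for the minimum total cover
problem: on every graph it halts after a number of steps that is bounded by a fixed polynomial in
the number of vertices, and outputs a total cover of size at most `ρ` times that of any other. -/
def IsPolyTimeApprox (ρ : ℕ) (p : RAM.Prog) : Prop :=
  ∃ B : Polynomial ℕ, ∀ (n : ℕ) (G : SimpleGraph (Fin n)), ∃ (k : ℕ) (s : RAM.State),
    RAM.Runs p (RAM.input G) k s ∧ k ≤ B.eval n ∧
    IsTotalCover G (RAM.output G s) ∧
    ∀ D : Set (Fin n ⊕ G.edgeSet), IsTotalCover G D → (RAM.output G s).ncard ≤ ρ * D.ncard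

end TotalCover

namespace TotalCover

universe u

variable {V : Type u} {G : SimpleGraph V} {M : G.Subgraph}

/-! Maximality of the matching matters only through the absence of augmenting paths with 1, 3 or 5
edges (`NoShortAugmentation`). Hence the algorithm can do without a maximum matching: local search
along such short paths is enough. Both halves then go through one notion, `IsGreedyCover`.

A greedy cover is a total cover (`IsGreedyCover.isTotalCover`). If an edge `xy` were uncovered, the
mates of its matched ends would be chosen as vertices, and each of those has an unmatched neighbour.
With one end unmatched, this gives an augmenting path of length 3, or else that end is bad. With
both ends matched, the distinct unmatched neighbours give one of length 5. Two adjacent unmatched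
vertices would be a path of length 1.

Its size is `m + k + t`, because it has one element for each matching edge, bad vertex and isolated
vertex (`IsGreedyCover.ncard_eq`). For the lower bound (`ncard_targets_le`), a total cover `D` hits
at most `2|D|` vertices, counting the ends of its edges, and these `m + k + t` objects inject into
the hit vertices. A matching edge goes to one of its hit ends, and a hit isolated or bad vertex to
itself. A bad vertex that is not hit has only hit neighbours, so it can go to the other end of the
matching edge in its triangle. No two bad vertices share that edge, since they would be joined by an
augmenting path of length 3.

The procedure yields greedy covers by an invariant (`Reachable.inv`). The program repeats the search
for short augmenting paths `n` times. Each round that changes anything matches more vertices, so a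
fixed point is reached. It then builds a greedy cover by running through the vertices instead of the
matching edges. Its time bound follows from its shape alone: every loop is a `for` loop up to `n`
(`exists_runs_compile`). -/

/-- `M` is a matching without augmenting paths of length `1`, `3` or `5`. -/
structure NoShortAugmentation (G : SimpleGraph V) (M : G.Subgraph) : Prop where
  isMatching : M.IsMatching
  one : ∀ ⦃a b : V⦄, a ∉ M.verts → b ∉ M.verts → ¬ G.Adj a b
  three : ∀ ⦃a b c d : V⦄, a ∉ M.verts → d ∉ M.verts → G.Adj a b → M.Adj b c → G.Adj c d → a = d
  five : ∀ ⦃a b c d e f : V⦄, a ∉ M.verts → f ∉ M.verts → G.Adj a b → M.Adj b c → G.Adj c d →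
    M.Adj d e → G.Adj e f → b ≠ d → a = f

/-! ### Maximum matchings have no augmenting paths -/

theorem exists_isMatching_insert [Finite V] (hM : M.IsMatching) {a b : V} (ha : a ∉ M.verts)
    (hb : b ∉ M.verts) (hab : G.Adj a b) :
    ∃ M' : G.Subgraph, M'.IsMatching ∧ M'.verts = M.verts ∪ {a, b} ∧
      M'.edgeSet.ncard = M.edgeSet.ncard + 1 := by
  refine ⟨M ⊔ G.subgraphOfAdj hab, ?_, ?_, ?_⟩
  · refine hM.sup (SimpleGraph.Subgraph.IsMatching.subgraphOfAdj hab) ?_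
    rw [hM.support_eq_verts, SimpleGraph.support_subgraphOfAdj, Set.disjoint_right]
    rintro x (rfl | rfl) <;> assumption
  · rfl
  · rw [SimpleGraph.Subgraph.edgeSet_sup, SimpleGraph.edgeSet_subgraphOfAdj, Set.union_singleton,
      Set.ncard_insert_of_notMem]
    intro h
    exact ha (M.edge_vert (SimpleGraph.Subgraph.mem_edgeSet.1 h))

/-- The last clause keeps the other matching edges at hand, so that the second matching edge of an
augmenting path of length 5 can be erased afterwards. -/
theorem exists_isMatching_erase [Finite V] (hM : M.IsMatching) {b c : V} (hbc : M.Adj b c) :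
    ∃ M' : G.Subgraph, M'.IsMatching ∧ M'.verts = M.verts \ {b, c} ∧
      M'.edgeSet.ncard + 1 = M.edgeSet.ncard ∧
      ∀ x y, M.Adj x y → x ≠ b → x ≠ c → M'.Adj x y := by
  have key : ∀ x y, M.Adj x y → x ≠ b → x ≠ c → y ≠ b ∧ y ≠ c := by
    intro x y h hb hc
    constructor
    · rintro rfl
      exact hc (hM.eq_of_adj_left h.symm hbc)
    · rintro rfl
      exact hb (hM.eq_of_adj_left h.symm hbc.symm)
  have hadj : ∀ x y, M.Adj x y → x ≠ b → x ≠ c → (M.deleteVerts {b, c}).Adj x y := by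
    intro x y h hb hc
    have := key x y h hb hc
    rw [SimpleGraph.Subgraph.deleteVerts_adj]
    have h1 := M.edge_vert h
    have h2 := M.edge_vert h.symm
    simp_all
  refine ⟨M.deleteVerts {b, c}, ?_, rfl, ?_, hadj⟩
  · rintro x ⟨hx, hx'⟩
    obtain ⟨y, hy, hy'⟩ := hM hx
    simp only [Set.mem_insert_iff, Set.mem_singleton_iff, not_or] at hx'
    refine ⟨y, hadj x y hy hx'.1 hx'.2, fun z hz => hy' z ?_⟩
    exact (SimpleGraph.Subgraph.deleteVerts_adj.1 hz).2.2.2.2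
  · have : (M.deleteVerts {b, c}).edgeSet = M.edgeSet \ {s(b, c)} := by
      ext e
      induction e using Sym2.ind with | _ x y =>
      simp only [SimpleGraph.Subgraph.mem_edgeSet, Set.mem_sdiff, Set.mem_singleton_iff]
      constructor
      · intro h
        rw [SimpleGraph.Subgraph.deleteVerts_adj] at h
        refine ⟨h.2.2.2.2, fun h' => ?_⟩
        have : x ∈ s(b, c) := h' ▸ Sym2.mem_mk_left x y
        exact h.2.1 (by simpa using this)
      · rintro ⟨h, h'⟩
        refine hadj x y h ?_ ?_
        · rintro rfl
          exact h' (by rw [hM.eq_of_adj_left h hbc])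
        · rintro rfl
          exact h' (by rw [hM.eq_of_adj_left h hbc.symm, Sym2.eq_swap])
    rw [this, Set.ncard_sdiff_singleton_add_one (SimpleGraph.Subgraph.mem_edgeSet.2 hbc)]

/-- Erasing the matching edges of an augmenting path and inserting the others one by one gains an
edge. The work lies in the distinctness of the path's vertices, which makes both ends of each
inserted edge free at its turn. -/
theorem IsMaximumMatching.noShortAugmentation [Finite V] (h : IsMaximumMatching G M) :
    NoShortAugmentation G M := by
  obtain ⟨hM, hmax⟩ := h
  refine ⟨hM, ?_, ?_, ?_⟩
  · intro a b ha hb hab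
    obtain ⟨M', h', -, hc⟩ := exists_isMatching_insert hM ha hb hab
    have := hmax M' h'
    lia
  · intro a b c d ha hd hab hbc hcd
    by_contra had
    have hb := M.edge_vert hbc
    have hc := M.edge_vert hbc.symm
    have hne := hbc.adj_sub.ne
    obtain ⟨M₁, h₁, v₁, c₁, -⟩ := exists_isMatching_erase hM hbc
    obtain ⟨M₂, h₂, v₂, c₂⟩ :=
      exists_isMatching_insert h₁ (a := a) (b := b) (by simp [v₁, ha]) (by simp [v₁]) hab
    obtain ⟨M₃, h₃, v₃, c₃⟩ := exists_isMatching_insert h₂ (a := c) (b := d)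
      (by simp [v₂, v₁]; grind) (by simp [v₂, v₁]; grind) hcd
    have := hmax M₃ h₃
    lia
  · intro a b c d e f ha hf hab hbc hcd hde hef hbd
    by_contra haf
    have hb := M.edge_vert hbc
    have hc := M.edge_vert hbc.symm
    have hd := M.edge_vert hde
    have he := M.edge_vert hde.symm
    have hne := hbc.adj_sub.ne
    have hne' := hde.adj_sub.ne
    have hcd' := hcd.ne
    have hce : c ≠ e := by
      rintro rfl
      exact hbd (hM.eq_of_adj_right hbc hde)
    have hbe : b ≠ e := by
      rintro rfl
      exact hcd' (hM.eq_of_adj_left hbc hde.symm)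
    obtain ⟨M₁, h₁, v₁, c₁, a₁⟩ := exists_isMatching_erase hM hbc
    obtain ⟨M₂, h₂, v₂, c₂, -⟩ := exists_isMatching_erase h₁ (a₁ d e hde hbd.symm hcd'.symm)
    obtain ⟨M₃, h₃, v₃, c₃⟩ :=
      exists_isMatching_insert h₂ (a := a) (b := b) (by simp [v₂, v₁, ha]) (by simp [v₂, v₁]) hab
    obtain ⟨M₄, h₄, v₄, c₄⟩ := exists_isMatching_insert h₃ (a := c) (b := d)
      (by simp [v₃, v₂, v₁]; grind) (by simp [v₃, v₂, v₁]; grind) hcd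
    obtain ⟨M₅, h₅, v₅, c₅⟩ := exists_isMatching_insert h₄ (a := e) (b := f)
      (by simp [v₄, v₃, v₂, v₁]; grind) (by simp [v₄, v₃, v₂, v₁]; grind) hef
    have := hmax M₅ h₅
    lia

/-! ### The structure of the covers found by the procedure -/

/-- `S` consists of the isolated vertices, the bad vertices, and one element of each matching edge:
the edge itself or one of its ends. Ends in `S` have distinct unmatched neighbours, and unmatched
vertices that are neither isolated nor bad have a neighbour in `S`. -/
structure IsGreedyCover (G : SimpleGraph V) (M : G.Subgraph) (S : Set (V ⊕ G.edgeSet)) : Prop where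
  unmatched : ∀ v ∉ M.verts, .inl v ∈ S ↔ v ∈ isolated G ∨ v ∈ bad G M
  edge_mem : ∀ e : G.edgeSet, .inr e ∈ S → e.1 ∈ M.edgeSet
  pick : ∀ (u v : V) (h : M.Adj u v),
    (.inr ⟨s(u, v), M.adj_sub h⟩ ∈ S ∧ .inl u ∉ S ∧ .inl v ∉ S) ∨
    (.inr ⟨s(u, v), M.adj_sub h⟩ ∉ S ∧ .inl u ∈ S ∧ .inl v ∉ S) ∨
    (.inr ⟨s(u, v), M.adj_sub h⟩ ∉ S ∧ .inl u ∉ S ∧ .inl v ∈ S)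
  witness : ∀ u ∈ M.verts, .inl u ∈ S → ∃ z ∉ M.verts, z ∉ bad G M ∧ G.Adj u z
  witness_pair : ∀ u ∈ M.verts, ∀ u' ∈ M.verts, .inl u ∈ S → .inl u' ∈ S → u ≠ u' →
    ∃ z ∉ M.verts, ∃ z' ∉ M.verts, G.Adj u z ∧ G.Adj u' z' ∧ z ≠ z'
  dominated : ∀ z ∉ M.verts, z ∉ bad G M → z ∉ isolated G → ∃ u, G.Adj z u ∧ .inl u ∈ S

theorem exists_adj_of_mem_verts (hM : M.IsMatching) {v : V} (hv : v ∈ M.verts) :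
    ∃ w, M.Adj v w := (hM hv).exists

/-- A vertex is hit by `S` if it lies in `S` or on an edge in `S`. -/
def hit (S : Set (V ⊕ G.edgeSet)) : Set V :=
  {v | .inl v ∈ S ∨ ∃ e : G.edgeSet, .inr e ∈ S ∧ v ∈ e.1}

/-- An edge is covered by itself, by an end, or by an edge sharing an end, and each of these hits
one of its ends. Covering all edges thus means that `hit S` is a vertex cover. -/
theorem covers_inr_iff (S : Set (V ⊕ G.edgeSet)) (e : G.edgeSet) :
    Covers G S (.inr e) ↔ ∃ v ∈ hit S, v ∈ e.1 := by
  constructor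
  · rintro (h | ⟨y | f, hy, h⟩)
    · obtain ⟨e, he⟩ := e
      induction e using Sym2.ind with | _ x y =>
      exact ⟨x, .inr ⟨_, h, by simp⟩, by simp⟩
    · exact ⟨y, .inl hy, h⟩
    · obtain ⟨-, v, h1, h2⟩ := h
      exact ⟨v, .inr ⟨f, hy, h2⟩, h1⟩
  · rintro ⟨v, h | ⟨f, hf, hv⟩, hve⟩
    · exact .inr ⟨.inl v, h, hve⟩
    · by_cases hef : e = f
      · exact .inl (hef ▸ hf)
      · exact .inr ⟨.inr f, hf, hef, v, hve, hv⟩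

theorem IsGreedyCover.isTotalCover {S : Set (V ⊕ G.edgeSet)} (hM : NoShortAugmentation G M)
    (hS : IsGreedyCover G M S) : IsTotalCover G S := by
  have mate : ∀ x y, M.Adj x y → x ∉ hit S → .inl y ∈ S := by
    intro x y hxy hx
    rcases hS.pick x y hxy with h | h | h
    · exact absurd (.inr ⟨_, h.1, by simp⟩) hx
    · exact absurd (.inl h.2.1) hx
    · exact h.2.2
  -- The chosen mate `y'` of `y` has an unmatched neighbour `z` that is not bad. The path `x`, `y`,
  -- `y'`, `z` forces `z = x`, but then `x` is bad because of `yy'`.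
  have half : ∀ x y, G.Adj x y → x ∉ M.verts → x ∉ hit S → y ∉ hit S → False := by
    intro x y hxy hx hhx hhy
    have hy : y ∈ M.verts := by_contra fun hy => hM.one hx hy hxy
    obtain ⟨y', hyy'⟩ := exists_adj_of_mem_verts hM.isMatching hy
    have hy' := mate _ _ hyy' hhy
    obtain ⟨z, hz, hzb, hyz⟩ := hS.witness y' (M.edge_vert hyy'.symm) hy'
    obtain rfl := hM.three hx hz hxy hyy' hyz
    exact hzb ⟨hx, y, y', hyy', hxy, hyz.symm⟩
  rintro (v | e)
  · by_cases hv : v ∈ M.verts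
    · obtain ⟨w, hw⟩ := exists_adj_of_mem_verts hM.isMatching hv
      rcases hS.pick v w hw with h | h | h
      · exact .inr ⟨_, h.1, Sym2.mem_mk_left v w⟩
      · exact .inl h.2.1
      · exact .inr ⟨_, h.2.2, hw.adj_sub⟩
    · by_cases h : v ∈ isolated G ∨ v ∈ bad G M
      · exact .inl ((hS.unmatched v hv).2 h)
      · rw [not_or] at h
        obtain ⟨u, hu, huS⟩ := hS.dominated v hv h.2 h.1
        exact .inr ⟨_, huS, hu⟩
  · rw [covers_inr_iff]
    obtain ⟨e, he⟩ := e
    induction e using Sym2.ind with | _ x y =>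
    have hxy : G.Adj x y := he
    by_contra hcon
    have hx : x ∉ hit S := fun h => hcon ⟨x, h, by simp⟩
    have hy : y ∉ hit S := fun h => hcon ⟨y, h, by simp⟩
    by_cases hxM : x ∈ M.verts
    swap
    · exact half x y hxy hxM hx hy
    by_cases hyM : y ∈ M.verts
    swap
    · exact half y x hxy.symm hyM hy hx
    obtain ⟨x', hx'⟩ := exists_adj_of_mem_verts hM.isMatching hxM
    obtain ⟨y', hy'⟩ := exists_adj_of_mem_verts hM.isMatching hyM
    have hxS := mate _ _ hx' hx
    have hyS := mate _ _ hy' hy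
    have hne : x' ≠ y' := by
      rintro rfl
      exact hxy.ne (hM.isMatching.eq_of_adj_right hx' hy')
    obtain ⟨z, hz, z', hz', h1, h2, h3⟩ := hS.witness_pair x' (M.edge_vert hx'.symm) y'
      (M.edge_vert hy'.symm) hxS hyS hne
    -- The augmenting path is `z`, `x'`, `x`, `y`, `y'`, `z'`. If `x'` were `y`, then `y` would be
    -- hit.
    refine h3 (hM.five hz hz' h1.symm hx'.symm hxy hy' h2 ?_)
    rintro rfl
    exact hy (.inl hxS)

/-! ### The size of a greedy cover -/

theorem not_mem_verts_of_mem_isolated {v : V} (hM : M.IsMatching) (hv : v ∈ isolated G) :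
    v ∉ M.verts := by
  intro h
  obtain ⟨w, hw⟩ := exists_adj_of_mem_verts hM h
  exact hv w hw.adj_sub

theorem eq_of_mem_edgeSet (hM : M.IsMatching) {e f : Sym2 V} (he : e ∈ M.edgeSet)
    (hf : f ∈ M.edgeSet) {v : V} (hve : v ∈ e) (hvf : v ∈ f) : e = f := by
  obtain ⟨x, rfl⟩ := Sym2.mem_iff_exists.1 hve
  obtain ⟨y, rfl⟩ := Sym2.mem_iff_exists.1 hvf
  rw [SimpleGraph.Subgraph.mem_edgeSet] at he hf
  rw [hM.eq_of_adj_left he hf]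

theorem mem_verts_of_mem_edgeSet {e : Sym2 V} (he : e ∈ M.edgeSet) {v : V} (hve : v ∈ e) :
    v ∈ M.verts := by
  obtain ⟨x, rfl⟩ := Sym2.mem_iff_exists.1 hve
  exact M.edge_vert he

/-- The isolated vertices, the bad vertices and the matching edges, as a disjoint union. -/
def targets (G : SimpleGraph V) (M : G.Subgraph) : Set (V ⊕ Sym2 V) :=
  Sum.inl '' (isolated G ∪ bad G M) ∪ Sum.inr '' M.edgeSet

theorem ncard_targets [Finite V] : (targets G M).ncard =
    M.edgeSet.ncard + (bad G M).ncard + (isolated G).ncard := by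
  rw [targets, Set.ncard_union_eq, Set.ncard_image_of_injective _ Sum.inl_injective,
    Set.ncard_image_of_injective _ Sum.inr_injective, Set.ncard_union_eq]
  · ring
  · rw [Set.disjoint_left]
    rintro v hv ⟨-, u, -, -, h, -⟩
    exact hv u h
  · rw [Set.disjoint_left]
    rintro _ ⟨v, -, rfl⟩ ⟨e, -, h⟩
    cases h

theorem not_mem_verts_of_inl_mem_targets (hM : M.IsMatching) {v : V}
    (hv : .inl v ∈ targets G M) : v ∉ M.verts := by
  have : v ∈ isolated G ∨ v ∈ bad G M := by simpa [targets] using hv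
  rcases this with h | h
  · exact not_mem_verts_of_mem_isolated hM h
  · exact h.1

theorem IsGreedyCover.ncard_eq [Finite V] {S : Set (V ⊕ G.edgeSet)} (hM : M.IsMatching)
    (hS : IsGreedyCover G M S) :
    S.ncard = M.edgeSet.ncard + (bad G M).ncard + (isolated G).ncard := by
  classical
  rw [← ncard_targets]
  -- A matched vertex stands for its matching edge, and everything else for itself. Injectivity on
  -- `S` is the statement that `pick` selects exactly one element per matching edge.
  let F : V ⊕ G.edgeSet → V ⊕ Sym2 V := fun x => match x with
    | .inl v => if h : ∃ w, M.Adj v w then .inr s(v, h.choose) else .inl v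
    | .inr e => .inr e.1
  have hF : ∀ {v w : V}, M.Adj v w → F (.inl v) = .inr s(v, w) := by
    intro v w h
    have h' : ∃ w, M.Adj v w := ⟨w, h⟩
    simp only [F, dif_pos h']
    rw [hM.eq_of_adj_left h'.choose_spec h]
  have hF' : ∀ {v : V}, v ∉ M.verts → F (.inl v) = .inl v := by
    intro v h
    have h' : ¬ ∃ w, M.Adj v w := fun ⟨w, hw⟩ => h (M.edge_vert hw)
    simp only [F, dif_neg h']
  refine Set.ncard_congr (fun x _ => F x) ?_ ?_ ?_
  · rintro (v | e) hx
    · by_cases hv : v ∈ M.verts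
      · obtain ⟨w, hw⟩ := exists_adj_of_mem_verts hM hv
        rw [hF hw]
        exact .inr ⟨_, hw, rfl⟩
      · rw [hF' hv]
        exact .inl ⟨v, (hS.unmatched v hv).1 hx, rfl⟩
    · exact .inr ⟨_, hS.edge_mem e hx, rfl⟩
  · rintro (v | e) (v' | e') hx hx' h
    · by_cases hv : v ∈ M.verts <;> by_cases hv' : v' ∈ M.verts
      · obtain ⟨w, hw⟩ := exists_adj_of_mem_verts hM hv
        obtain ⟨w', hw'⟩ := exists_adj_of_mem_verts hM hv'
        rw [hF hw, hF hw'] at h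
        have hmem : v ∈ s(v', w') := Sum.inr_injective h ▸ Sym2.mem_mk_left v w
        rcases Sym2.mem_iff.1 hmem with rfl | rfl
        · rfl
        · have := hS.pick v' v hw'
          tauto
      · obtain ⟨w, hw⟩ := exists_adj_of_mem_verts hM hv
        rw [hF hw, hF' hv'] at h
        cases h
      · obtain ⟨w', hw'⟩ := exists_adj_of_mem_verts hM hv'
        rw [hF' hv, hF hw'] at h
        cases h
      · rw [hF' hv, hF' hv'] at h
        rw [Sum.inl_injective h]
    · by_cases hv : v ∈ M.verts
      · obtain ⟨w, hw⟩ := exists_adj_of_mem_verts hM hv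
        rw [hF hw] at h
        obtain ⟨e', he'⟩ := e'
        obtain rfl : s(v, w) = e' := Sum.inr_injective h
        have := hS.pick v w hw
        tauto
      · rw [hF' hv] at h
        cases h
    · by_cases hv : v' ∈ M.verts
      · obtain ⟨w, hw⟩ := exists_adj_of_mem_verts hM hv
        rw [hF hw] at h
        obtain ⟨e', he'⟩ := e
        obtain rfl : e' = s(v', w) := Sum.inr_injective h
        have := hS.pick v' w hw
        tauto
      · rw [hF' hv] at h
        cases h
    · exact congrArg Sum.inr (Subtype.ext (Sum.inr_injective h))
  · rintro (v | e) hb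
    · have hv := not_mem_verts_of_inl_mem_targets hM hb
      exact ⟨.inl v, (hS.unmatched v hv).2 (by simpa [targets] using hb), hF' hv⟩
    · have he : e ∈ M.edgeSet := by simpa [targets] using hb
      induction e using Sym2.ind with | _ x y =>
      have hxy : M.Adj x y := he
      rcases hS.pick x y hxy with h | h | h
      · exact ⟨_, h.1, rfl⟩
      · exact ⟨_, h.2.1, hF hxy⟩
      · exact ⟨_, h.2.2, by rw [hF hxy.symm, Sym2.eq_swap]⟩

/-! ### The lower bound -/

theorem ncard_hit_le [Finite V] (D : Set (V ⊕ G.edgeSet)) : (hit D).ncard ≤ 2 * D.ncard := by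
  classical
  let := Fintype.ofFinite V
  have hD := D.toFinite
  let t : V ⊕ G.edgeSet → Finset V := fun x => match x with
    | .inl v => {v}
    | .inr e => e.1.toFinset
  have hsub : hit D ⊆ (hD.toFinset.biUnion t : Finset V) := by
    rintro v (hv | ⟨e, he, hve⟩)
    · exact Finset.mem_coe.2 (Finset.mem_biUnion.2 ⟨.inl v, by simpa using hv, by simp [t]⟩)
    · exact Finset.mem_coe.2 (Finset.mem_biUnion.2 ⟨.inr e, by simpa using he, by simpa [t] using hve⟩)
  calc (hit D).ncard ≤ (hD.toFinset.biUnion t).card := by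
        rw [← Set.ncard_coe_finset]
        exact Set.ncard_le_ncard hsub (Finset.finite_toSet _)
    _ ≤ hD.toFinset.card * 2 := by
        refine Finset.card_biUnion_le_card_mul _ _ _ ?_
        rintro (v | ⟨e, he⟩) -
        · simp [t]
        · induction e using Sym2.ind with | _ x y =>
          simp only [t, Sym2.toFinset_mk_eq]
          exact Finset.card_le_two
    _ = 2 * D.ncard := by rw [Set.ncard_eq_toFinset_card D hD, mul_comm]

theorem ncard_targets_le [Finite V] (hM : NoShortAugmentation G M) {D : Set (V ⊕ G.edgeSet)}
    (hD : IsTotalCover G D) : (targets G M).ncard ≤ 2 * D.ncard := by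
  classical
  refine le_trans ?_ (ncard_hit_le D)
  have hp : ∀ e ∈ M.edgeSet, ∃ p ∈ hit D, p ∈ e := fun e he =>
    (covers_inr_iff D ⟨e, M.edgeSet_subset he⟩).1 (hD _)
  have hcov : ∀ x y, G.Adj x y → x ∉ hit D → y ∈ hit D := by
    intro x y hxy hx
    obtain ⟨v, hv, hve⟩ := (covers_inr_iff D ⟨s(x, y), hxy⟩).1 (hD _)
    rcases Sym2.mem_iff.1 hve with rfl | rfl
    · exact absurd hv hx
    · exact hv
  have hiso : ∀ v ∈ isolated G, v ∈ hit D := by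
    intro v hv
    rcases hD (.inl v) with h | ⟨u | e, hu, h⟩
    · exact .inl h
    · exact absurd h (hv u)
    · exact .inr ⟨e, hu, h⟩
  -- `choose!` needs a default value in `V`.
  rcases isEmpty_or_nonempty V with hV | hV
  · simp [Set.eq_empty_of_isEmpty]
  choose! p hpD hpe using hp
  -- All neighbours of a vertex that is not hit are hit, so both ends of the matching edge are
  -- available and the one not taken by `p` is chosen.
  have hq : ∀ w ∈ bad G M, w ∉ hit D → ∃ q ∈ hit D, ∃ r, M.Adj q r ∧ G.Adj w q ∧ G.Adj w r ∧
      q ≠ p s(q, r) := by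
    rintro w ⟨-, u, v, huv, hwu, hwv⟩ hwD
    by_cases h : u = p s(u, v)
    · refine ⟨v, hcov _ _ hwv hwD, u, huv.symm, hwv, hwu, ?_⟩
      rw [Sym2.eq_swap, ← h]
      exact huv.adj_sub.ne'
    · exact ⟨u, hcov _ _ hwu hwD, v, huv, hwu, hwv, h⟩
  choose! q hqD r hqr hwq hwr hqp using hq
  let F : V ⊕ Sym2 V → V := fun x => match x with
    | .inl v => if v ∈ hit D then v else q v
    | .inr e => p e
  have hbad : ∀ v, .inl v ∈ targets G M → v ∉ hit D → v ∈ bad G M := by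
    intro v hv hvD
    have : v ∈ isolated G ∨ v ∈ bad G M := by simpa [targets] using hv
    exact this.resolve_left fun h => hvD (hiso v h)
  have hedge : ∀ e, .inr e ∈ targets G M → e ∈ M.edgeSet := by
    intro e he
    simpa [targets] using he
  have cross : ∀ v e, .inl v ∈ targets G M → .inr e ∈ targets G M → F (.inl v) ≠ F (.inr e) := by
    intro v e hv he
    simp only [F]
    split_ifs with h
    · rintro rfl
      exact not_mem_verts_of_inl_mem_targets hM.isMatching hv
        (mem_verts_of_mem_edgeSet (hedge e he) (hpe e (hedge e he)))
    · intro hqe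
      have hb := hbad v hv h
      have := eq_of_mem_edgeSet hM.isMatching (e := s(q v, r v)) (hqr v hb h) (hedge e he)
        (Sym2.mem_mk_left _ _) (hqe ▸ hpe e (hedge e he))
      exact hqp v hb h (this ▸ hqe)
  refine Set.ncard_le_ncard_of_injOn F ?_ ?_
  · rintro (v | e) hx
    · simp only [F]
      split_ifs with h
      · exact h
      · exact hqD v (hbad v hx h) h
    · exact hpD e (hedge e hx)
  · rintro (v | e) hx (v' | e') hx' h
    · congr 1
      have hv := not_mem_verts_of_inl_mem_targets hM.isMatching hx
      have hv' := not_mem_verts_of_inl_mem_targets hM.isMatching hx'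
      simp only [F] at h
      split_ifs at h with h1 h2 h2
      · exact h
      · exact absurd (h ▸ M.edge_vert (hqr v' (hbad v' hx' h2) h2)) hv
      · exact absurd (h ▸ M.edge_vert (hqr v (hbad v hx h1) h1)) hv'
      · have hb := hbad v hx h1
        have hb' := hbad v' hx' h2
        -- If `q v = q v'`, then `v`, `r v`, `q v`, `v'` would be an augmenting path unless `v =
        -- v'`.
        refine hM.three hv hv' (hwr v hb h1) (hqr v hb h1).symm ?_
        rw [h]
        exact (hwq v' hb' h2).symm
    · exact absurd h (cross v e' hx hx')
    · exact absurd h.symm (cross v' e hx' hx)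
    · congr 1
      have := hpe e (hedge e hx)
      have h' : p e = p e' := h
      rw [h'] at this
      exact eq_of_mem_edgeSet hM.isMatching (hedge e hx) (hedge e' hx') this (hpe e' (hedge e' hx'))

theorem IsGreedyCover.ncard_le [Finite V] {S D : Set (V ⊕ G.edgeSet)}
    (hM : NoShortAugmentation G M) (hS : IsGreedyCover G M S) (hD : IsTotalCover G D) :
    S.ncard ≤ 2 * D.ncard := by
  rw [hS.ncard_eq hM.isMatching, ← ncard_targets]
  exact ncard_targets_le hM hD

end TotalCover

namespace TotalCover

universe u

variable {V : Type u} {G : SimpleGraph V} {M : G.Subgraph}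

/-! ### Invariants of the greedy procedure -/

/-- What holds while bad vertices are being removed. -/
structure RemovingInv (G : SimpleGraph V) (M : G.Subgraph) (R : Set V)
    (S : Set (V ⊕ G.edgeSet)) : Prop where
  not_isolated : ∀ v ∈ R, v ∉ isolated G
  mate_mem : ∀ u v, M.Adj u v → u ∈ R → v ∈ R
  good_mem : ∀ v ∉ M.verts, v ∉ isolated G → v ∉ bad G M → v ∈ R
  vertex_iff : ∀ v, .inl v ∈ S ↔ v ∈ isolated G ∨ v ∈ bad G M ∧ v ∉ R
  edge_mem : ∀ e : G.edgeSet, .inr e ∈ S → e.1 ∈ M.edgeSet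
  edge_iff : ∀ (u v : V) (h : M.Adj u v), .inr ⟨s(u, v), M.adj_sub h⟩ ∈ S ↔ u ∉ R
  triangle : ∀ u v, M.Adj u v → u ∉ R → ∃ w ∈ bad G M, w ∉ R ∧ G.Adj w u ∧ G.Adj w v

/-- What holds while the remaining matching edges are being picked. -/
structure PickingInv (G : SimpleGraph V) (M : G.Subgraph) (R : Set V) (Q : Set (Sym2 V))
    (S : Set (V ⊕ G.edgeSet)) : Prop where
  not_isolated : ∀ v ∈ R, v ∉ isolated G
  not_bad : ∀ v ∈ R, v ∉ bad G M
  good_mem : ∀ v ∉ M.verts, v ∉ isolated G → v ∉ bad G M → v ∈ R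
  queue_subset : Q ⊆ M.edgeSet
  unmatched : ∀ v ∉ M.verts, .inl v ∈ S ↔ v ∈ isolated G ∨ v ∈ bad G M
  edge_mem : ∀ e : G.edgeSet, .inr e ∈ S → e.1 ∈ M.edgeSet
  pending : ∀ (u v : V) (h : M.Adj u v), s(u, v) ∈ Q →
    .inr ⟨s(u, v), M.adj_sub h⟩ ∉ S ∧ .inl u ∉ S ∧ .inl v ∉ S
  pick : ∀ (u v : V) (h : M.Adj u v), s(u, v) ∉ Q →
    (.inr ⟨s(u, v), M.adj_sub h⟩ ∈ S ∧ .inl u ∉ S ∧ .inl v ∉ S) ∨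
    (.inr ⟨s(u, v), M.adj_sub h⟩ ∉ S ∧ .inl u ∈ S ∧ .inl v ∉ S) ∨
    (.inr ⟨s(u, v), M.adj_sub h⟩ ∉ S ∧ .inl u ∉ S ∧ .inl v ∈ S)
  witness : ∀ u ∈ M.verts, .inl u ∈ S → ∃ z ∉ M.verts, z ∉ bad G M ∧ G.Adj u z
  witness_pair : ∀ u ∈ M.verts, ∀ u' ∈ M.verts, .inl u ∈ S → .inl u' ∈ S → u ≠ u' →
    ∃ z ∉ M.verts, ∃ z' ∉ M.verts, G.Adj u z ∧ G.Adj u' z' ∧ z ≠ z'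
  dominated : ∀ z ∉ M.verts, z ∈ R → ∀ u v, M.Adj u v → G.Adj z u →
    s(u, v) ∈ Q ∨ ∃ u', G.Adj z u' ∧ .inl u' ∈ S

/-- The invariant of the procedure. -/
def Config.Inv (M : G.Subgraph) : Config G → Prop
  | .removing R S => RemovingInv G M R S
  | .picking R Q S => PickingInv G M R Q S

theorem removingInv_start (hM : M.IsMatching) :
    RemovingInv G M (isolated G)ᶜ (Sum.inl '' isolated G) where
  not_isolated v hv := hv
  mate_mem u v h _ hv := hv u h.adj_sub.symm
  good_mem v _ h _ := h
  vertex_iff v := by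
    constructor
    · rintro ⟨w, hw, h⟩
      cases h
      exact .inl hw
    · rintro (h | ⟨h, h'⟩)
      · exact ⟨v, h, rfl⟩
      · exact ⟨v, by simpa using h', rfl⟩
  edge_mem := by rintro e ⟨w, -, h⟩; cases h
  edge_iff u v h := by
    refine iff_of_false ?_ ?_
    · rintro ⟨w, -, h⟩
      cases h
    · intro hu
      exact not_mem_verts_of_mem_isolated hM (by simpa using hu) (M.edge_vert h)
  triangle u v h hu :=
    absurd (M.edge_vert h) (not_mem_verts_of_mem_isolated hM (by simpa using hu))

theorem RemovingInv.remove (hM : M.IsMatching) {R : Set V} {S : Set (V ⊕ G.edgeSet)} {w u v : V}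
    (h : RemovingInv G M R S) (hw : w ∈ bad G M) (huv : M.Adj u v) (hwR : w ∈ R) (huR : u ∈ R)
    (hwu : G.Adj w u) (hwv : G.Adj w v) :
    RemovingInv G M (R \ {w, u, v}) (S ∪ {.inl w, .inr ⟨s(u, v), M.adj_sub huv⟩}) := by
  have hwM : w ∉ M.verts := hw.1
  have hu := M.edge_vert huv
  have hv := M.edge_vert huv.symm
  have hvR := h.mate_mem u v huv huR
  -- As `M` is a matching, losing `u` and `v` affects no matching edge other than `uv`.
  have key : ∀ x y, M.Adj x y → ((x = u ∨ x = v) ↔ s(x, y) = s(u, v)) := by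
    intro x y hxy
    constructor
    · rintro (rfl | rfl)
      · rw [hM.eq_of_adj_left hxy huv]
      · rw [hM.eq_of_adj_left hxy huv.symm, Sym2.eq_swap]
    · intro e
      have : x ∈ s(u, v) := e ▸ Sym2.mem_mk_left x y
      exact Sym2.mem_iff.1 this
  constructor
  · rintro x ⟨hx, -⟩
    exact h.not_isolated x hx
  · rintro x y hxy ⟨hx, hx'⟩
    refine ⟨h.mate_mem x y hxy hx, ?_⟩
    simp only [Set.mem_insert_iff, Set.mem_singleton_iff, not_or] at hx' ⊢
    have h1 := key x y hxy
    have h2 := key y x hxy.symm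
    rw [Sym2.eq_swap] at h2
    refine ⟨?_, ?_⟩
    · rintro rfl
      exact hwM (M.edge_vert hxy.symm)
    · tauto
  · intro x hx hxi hxb
    refine ⟨h.good_mem x hx hxi hxb, ?_⟩
    rintro (rfl | rfl | rfl)
    · exact hxb hw
    · exact hx hu
    · exact hx hv
  · intro x
    have := h.vertex_iff x
    simp only [Set.mem_union, Set.mem_insert_iff, Set.mem_singleton_iff, Sum.inl.injEq, reduceCtorEq,
      or_false, Set.mem_sdiff, this]
    constructor
    · rintro ((h1 | h1) | rfl)
      · exact .inl h1
      · exact .inr ⟨h1.1, fun h2 => h1.2 h2.1⟩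
      · exact .inr ⟨hw, fun h2 => h2.2 (.inl rfl)⟩
    · rintro (h1 | ⟨h1, h2⟩)
      · exact .inl (.inl h1)
      · by_cases hxw : x = w
        · exact .inr hxw
        · refine .inl (.inr ⟨h1, fun h3 => h2 ⟨h3, ?_⟩⟩)
          rintro (rfl | rfl | rfl)
          · exact hxw rfl
          · exact h1.1 hu
          · exact h1.1 hv
  · rintro e (he | he | he)
    · exact h.edge_mem e he
    · cases he
    · cases he
      exact huv
  · intro x y hxy
    have h1 := h.edge_iff x y hxy
    have h2 := key x y hxy
    have h3 : x ≠ w := by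
      rintro rfl
      exact hwM (M.edge_vert hxy)
    simp only [Set.mem_union, h1, Set.mem_insert_iff, Set.mem_singleton_iff, reduceCtorEq,
      Sum.inr.injEq, Subtype.ext_iff, ← h2, Set.mem_sdiff]
    tauto
  · intro x y hxy hx
    by_cases hxR : x ∈ R
    · refine ⟨w, hw, fun h' => h'.2 (.inl rfl), ?_⟩
      have : x = w ∨ x = u ∨ x = v := by
        by_contra h'
        exact hx ⟨hxR, h'⟩
      rcases this with rfl | rfl | rfl
      · exact absurd (M.edge_vert hxy) hwM
      · rw [hM.eq_of_adj_left hxy huv]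
        exact ⟨hwu, hwv⟩
      · rw [hM.eq_of_adj_left hxy huv.symm]
        exact ⟨hwv, hwu⟩
    · obtain ⟨w', h1, h2, h3⟩ := h.triangle x y hxy hxR
      exact ⟨w', h1, fun h' => h2 h'.1, h3⟩

theorem RemovingInv.not_inl_mem (hM : M.IsMatching) {R : Set V} {S : Set (V ⊕ G.edgeSet)}
    (h : RemovingInv G M R S) {v : V} (hv : v ∈ M.verts) : .inl v ∉ S := by
  rw [h.vertex_iff]
  rintro (h' | h')
  · exact not_mem_verts_of_mem_isolated hM h' hv
  · exact h'.1.1 hv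

theorem RemovingInv.switch (hM : NoShortAugmentation G M) {R : Set V} {S : Set (V ⊕ G.edgeSet)}
    (h : RemovingInv G M R S) (hb : ∀ w ∈ R, w ∉ bad G M) :
    PickingInv G M R {e | e ∈ M.edgeSet ∧ ∀ x ∈ e, x ∈ R} S := by
  have key : ∀ u v, M.Adj u v → (s(u, v) ∈ {e | e ∈ M.edgeSet ∧ ∀ x ∈ e, x ∈ R} ↔ u ∈ R) := by
    intro u v huv
    constructor
    · rintro ⟨-, h1⟩
      exact h1 u (by simp)
    · intro hu
      refine ⟨huv, ?_⟩
      simp [hu, h.mate_mem u v huv hu]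
  constructor
  · exact h.not_isolated
  · exact hb
  · exact h.good_mem
  · exact fun e he => he.1
  · intro v hv
    rw [h.vertex_iff]
    constructor
    · tauto
    · rintro (h1 | h1)
      · exact .inl h1
      · exact .inr ⟨h1, fun h2 => hb v h2 h1⟩
  · exact h.edge_mem
  · intro u v huv hQ
    rw [key u v huv] at hQ
    rw [h.edge_iff u v huv]
    exact ⟨not_not.2 hQ, h.not_inl_mem hM.isMatching (M.edge_vert huv),
      h.not_inl_mem hM.isMatching (M.edge_vert huv.symm)⟩
  · intro u v huv hQ
    rw [key u v huv] at hQ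
    refine .inl ⟨(h.edge_iff u v huv).2 hQ, h.not_inl_mem hM.isMatching (M.edge_vert huv),
      h.not_inl_mem hM.isMatching (M.edge_vert huv.symm)⟩
  · intro u hu hS
    exact absurd hS (h.not_inl_mem hM.isMatching hu)
  · intro u hu _ _ hS
    exact absurd hS (h.not_inl_mem hM.isMatching hu)
  · intro z hz hzR u v huv hzu
    rw [key u v huv]
    by_contra hcon
    rw [not_or] at hcon
    -- If the edge `uv` had been removed, it went with a bad vertex `w` adjacent to `v`. The path
    -- `z`, `u`, `v`, `w` gives `z = w`, although `z` is still there.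
    obtain ⟨w, hw, hwR, hwu, hwv⟩ := h.triangle u v huv hcon.1
    obtain rfl := hM.three hz hw.1 hzu huv hwv.symm
    exact hwR hzR

theorem edge_eq_of_mem (hM : M.IsMatching) {u v x y : V} (huv : M.Adj u v) (hxy : M.Adj x y)
    (h : u = x ∨ u = y) : s(x, y) = s(u, v) := by
  rcases h with rfl | rfl
  · rw [hM.eq_of_adj_left hxy huv]
  · rw [hM.eq_of_adj_left hxy.symm huv, Sym2.eq_swap]

theorem PickingInv.pickVertex (hM : NoShortAugmentation G M) {R : Set V} {Q : Set (Sym2 V)}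
    {S : Set (V ⊕ G.edgeSet)} {u v z : V} (h : PickingInv G M R Q S)
    (huv : M.Adj u v) (hQ : s(u, v) ∈ Q) (hzR : z ∈ R) (hzM : z ∉ M.verts) (huz : G.Adj u z)
    (hz : ¬ Covers G S (.inl z)) :
    PickingInv G M R (Q \ {s(u, v)}) (S ∪ {.inl u}) := by
  have hu := M.edge_vert huv
  have hnew : ∀ x, .inl x ∈ S ∪ {(.inl u : V ⊕ G.edgeSet)} ↔ .inl x ∈ S ∨ x = u := by
    intro x
    simp [or_comm]
  have hold : ∀ e, .inr e ∈ S ∪ {(.inl u : V ⊕ G.edgeSet)} ↔ .inr e ∈ S := by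
    intro x
    simp
  constructor
  · exact h.not_isolated
  · exact h.not_bad
  · exact h.good_mem
  · exact fun e he => h.queue_subset he.1
  · intro x hx
    rw [hnew, ← h.unmatched x hx, or_iff_left]
    rintro rfl
    exact hx hu
  · intro e he
    exact h.edge_mem e ((hold e).1 he)
  · rintro x y hxy ⟨hxQ, hne⟩
    have := h.pending x y hxy hxQ
    rw [hold, hnew, hnew]
    have h1 : ¬ (u = x ∨ u = y) := fun h' => hne (edge_eq_of_mem hM.isMatching huv hxy h')
    grind
  · intro x y hxy hxQ
    by_cases he : s(x, y) ∈ Q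
    · have h1 : s(x, y) = s(u, v) := by
        by_contra h'
        exact hxQ ⟨he, h'⟩
      have h2 := h.pending x y hxy he
      have hne := hxy.adj_sub.ne
      rw [hold, hnew, hnew]
      rcases Sym2.eq_iff.1 h1 with ⟨rfl, rfl⟩ | ⟨rfl, rfl⟩ <;> grind
    · have h1 : ¬ (u = x ∨ u = y) := by
        intro h'
        exact he (edge_eq_of_mem hM.isMatching huv hxy h' ▸ hQ)
      have := h.pick x y hxy he
      rw [hold, hnew, hnew]
      grind
  · intro x hx hxS
    rcases (hnew x).1 hxS with h1 | rfl
    · exact h.witness x hx h1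
    · exact ⟨z, hzM, h.not_bad z hzR, huz⟩
  · have key : ∀ x ∈ M.verts, .inl x ∈ S →
        ∃ z' ∉ M.verts, G.Adj x z' ∧ z ≠ z' := by
      intro x hx hxS
      obtain ⟨z', h1, -, h2⟩ := h.witness x hx hxS
      refine ⟨z', h1, h2, ?_⟩
      rintro rfl
      exact hz (.inr ⟨_, hxS, h2.symm⟩)
    intro x hx y hy hxS hyS hne
    rcases (hnew x).1 hxS with h1 | rfl <;> rcases (hnew y).1 hyS with h2 | rfl
    · exact h.witness_pair x hx y hy h1 h2 hne
    · obtain ⟨z', h3, h4, h5⟩ := key x hx h1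
      exact ⟨z', h3, z, hzM, h4, huz, h5.symm⟩
    · obtain ⟨z', h3, h4, h5⟩ := key y hy h2
      exact ⟨z, hzM, z', h3, huz, h4, h5⟩
    · exact absurd rfl hne
  · intro x hx hxR a b hab hxa
    rcases h.dominated x hx hxR a b hab hxa with h1 | ⟨u', h1, h2⟩
    · by_cases he : s(a, b) = s(u, v)
      · right
        rcases Sym2.eq_iff.1 he with ⟨rfl, rfl⟩ | ⟨rfl, rfl⟩
        · exact ⟨a, hxa, (hnew _).2 (.inr rfl)⟩
        -- Here `x` is adjacent to the end that was not chosen, so there is a path of length 3 from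
        -- `x` to `z`. Hence `x = z`, which the chosen end dominates.
        · obtain rfl := hM.three hx hzM hxa hab huz
          exact ⟨b, huz.symm, (hnew _).2 (.inr rfl)⟩
      · exact .inl ⟨h1, he⟩
    · exact .inr ⟨u', h1, .inl h2⟩

theorem PickingInv.pickEdge {R : Set V} {Q : Set (Sym2 V)}
    {S : Set (V ⊕ G.edgeSet)} {u v : V} (h : PickingInv G M R Q S)
    (huv : M.Adj u v) (hQ : s(u, v) ∈ Q)
    (hc : ∀ z ∈ R, z ∉ M.verts → G.Adj u z ∨ G.Adj v z → Covers G S (.inl z)) :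
    PickingInv G M R (Q \ {s(u, v)}) (S ∪ {.inr ⟨s(u, v), M.adj_sub huv⟩}) := by
  have hold : ∀ x, .inl x ∈ S ∪ {(.inr ⟨s(u, v), M.adj_sub huv⟩ : V ⊕ G.edgeSet)} ↔
      .inl x ∈ S := by
    intro x
    simp
  have hnew : ∀ e, .inr e ∈ S ∪ {(.inr ⟨s(u, v), M.adj_sub huv⟩ : V ⊕ G.edgeSet)} ↔
      .inr e ∈ S ∨ e.1 = s(u, v) := by
    intro x
    simp [Subtype.ext_iff, or_comm]
  constructor
  · exact h.not_isolated
  · exact h.not_bad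
  · exact h.good_mem
  · exact fun e he => h.queue_subset he.1
  · intro x hx
    rw [hold, h.unmatched x hx]
  · intro e he
    rcases (hnew e).1 he with h1 | h1
    · exact h.edge_mem e h1
    · rw [h1]
      exact huv
  · rintro x y hxy ⟨hxQ, hne⟩
    have := h.pending x y hxy hxQ
    rw [hold, hnew, hold]
    exact ⟨not_or.2 ⟨this.1, hne⟩, this.2⟩
  · intro x y hxy hxQ
    rw [hold, hnew, hold]
    by_cases he : s(x, y) ∈ Q
    · have h1 : s(x, y) = s(u, v) := by
        by_contra h'
        exact hxQ ⟨he, h'⟩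
      exact .inl ⟨.inr h1, (h.pending x y hxy he).2⟩
    · have h1 : s(x, y) ≠ s(u, v) := by
        intro h'
        exact he (h' ▸ hQ)
      rw [or_iff_left h1]
      exact h.pick x y hxy he
  · intro x hx hxS
    exact h.witness x hx ((hold x).1 hxS)
  · intro x hx y hy hxS hyS hne
    exact h.witness_pair x hx y hy ((hold x).1 hxS) ((hold y).1 hyS) hne
  · intro x hx hxR a b hab hxa
    rcases h.dominated x hx hxR a b hab hxa with h1 | ⟨u', h1, h2⟩
    · by_cases he : s(a, b) = s(u, v)
      · right
        -- The remaining unmatched vertex `x` is neither isolated nor bad, so it is not in `S`. It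
        -- also lies on no edge of `S`, all of which are matching edges. Being covered thus means
        -- having a neighbour in `S`.
        have hcov : Covers G S (.inl x) := by
          refine hc x hxR hx ?_
          rcases Sym2.eq_iff.1 he with ⟨rfl, rfl⟩ | ⟨rfl, rfl⟩
          · exact .inl hxa.symm
          · exact .inr hxa.symm
        rcases hcov with h2 | ⟨u' | e, hu', h2⟩
        · rcases (h.unmatched x hx).1 h2 with h3 | h3
          · exact absurd h3 (h.not_isolated x hxR)
          · exact absurd h3 (h.not_bad x hxR)
        · exact ⟨u', h2, .inl hu'⟩
        · exact absurd (mem_verts_of_mem_edgeSet (h.edge_mem e hu') h2) hx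
      · exact .inl ⟨h1, he⟩
    · exact .inr ⟨u', h1, .inl h2⟩

theorem Step.inv (hM : NoShortAugmentation G M) {c c' : Config G} (h : Step G M c c')
    (hc : c.Inv M) : c'.Inv M := by
  cases h with
  | remove hw huv hwR huR _ hwu hwv => exact RemovingInv.remove hM.isMatching hc hw huv hwR huR hwu hwv
  | switch h => exact RemovingInv.switch hM hc h
  | pickVertex huv hQ hzR hzM huz hz => exact PickingInv.pickVertex hM hc huv hQ hzR hzM huz hz
  | pickEdge huv hQ h => exact PickingInv.pickEdge hc huv hQ h

theorem Reachable.inv (hM : NoShortAugmentation G M) {c : Config G} (h : Reachable G M c) :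
    c.Inv M := by
  induction h with
  | refl => exact removingInv_start hM.isMatching
  | tail _ h ih => exact h.inv hM ih

theorem PickingInv.isGreedyCover {R : Set V} {S : Set (V ⊕ G.edgeSet)} (hM : NoShortAugmentation G M)
    (h : PickingInv G M R ∅ S) : IsGreedyCover G M S where
  unmatched := h.unmatched
  edge_mem := h.edge_mem
  pick u v huv := h.pick u v huv (Set.notMem_empty _)
  witness := h.witness
  witness_pair := h.witness_pair
  dominated z hz hzb hzi := by
    obtain ⟨u, hu⟩ : ∃ u, G.Adj z u := by
      by_contra hcon
      exact hzi fun u hu => hcon ⟨u, hu⟩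
    have huM : u ∈ M.verts := by_contra fun h' => hM.one hz h' hu
    obtain ⟨v, huv⟩ := exists_adj_of_mem_verts hM.isMatching huM
    simpa using h.dominated z hz (h.good_mem z hz hzi hzb) u v huv hu

/-! ### Completing partial runs -/

theorem exists_final_of_picking [Finite V] (R : Set V) (Q : Set (Sym2 V)) (S : Set (V ⊕ G.edgeSet))
    (hQ : Q ⊆ M.edgeSet) : ∃ (c' : Config G) (S' : Set (V ⊕ G.edgeSet)),
      Relation.ReflTransGen (Step G M) (.picking R Q S) c' ∧ c'.IsFinal S' := by
  induction hk : Q.ncard generalizing Q S with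
  | zero =>
    obtain rfl : Q = ∅ := (Set.ncard_eq_zero).1 hk
    exact ⟨_, S, .refl, R, rfl⟩
  | succ k ih =>
    obtain ⟨e, he⟩ : Q.Nonempty := Set.nonempty_of_ncard_ne_zero (by lia)
    have hk' : (Q \ {e}).ncard = k := by
      rw [Set.ncard_sdiff_singleton_of_mem he]
      lia
    have hM' : e ∈ M.edgeSet := hQ he
    have hQ' : Q \ {e} ⊆ M.edgeSet := Set.sdiff_subset.trans hQ
    induction e using Sym2.ind with | _ u v =>
    have huv : M.Adj u v := hM'
    by_cases h : ∀ z ∈ R, z ∉ M.verts → G.Adj u z ∨ G.Adj v z → Covers G S (.inl z)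
    · obtain ⟨c', S', h1, h2⟩ := ih (Q \ {s(u, v)}) _ hQ' hk'
      exact ⟨c', S', .head (.pickEdge huv he h) h1, h2⟩
    · push Not at h
      obtain ⟨z, hzR, hz, hadj, hcov⟩ := h
      rcases hadj with hadj | hadj
      · obtain ⟨c', S', h1, h2⟩ := ih (Q \ {s(u, v)}) _ hQ' hk'
        exact ⟨c', S', .head (.pickVertex huv he hzR hz hadj hcov) h1, h2⟩
      -- The vertex rule selects the first end, so the edge is read in the other direction.
      · rw [Sym2.eq_swap] at he hQ' hk'
        obtain ⟨c', S', h1, h2⟩ := ih (Q \ {s(v, u)}) _ hQ' hk'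
        exact ⟨c', S', .head (.pickVertex huv.symm he hzR hz hadj hcov) h1, h2⟩

/-- A remaining bad vertex `w` never loses its triangle edge `uv`: a bad vertex `w'` removed with
that edge would be joined to `w` by an augmenting path of length 3. So removal can go on until no
bad vertex is left, and each removal shrinks `R`. -/
theorem exists_final_of_removing [Finite V] (hM : NoShortAugmentation G M) (R : Set V)
    (S : Set (V ⊕ G.edgeSet)) (hI : RemovingInv G M R S) :
    ∃ (c' : Config G) (S' : Set (V ⊕ G.edgeSet)),
      Relation.ReflTransGen (Step G M) (.removing R S) c' ∧ c'.IsFinal S' := by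
  induction hk : R.ncard using Nat.strong_induction_on generalizing R S with
  | _ k ih =>
    subst hk
    by_cases h : ∀ w ∈ R, w ∉ bad G M
    · obtain ⟨c', S', h1, h2⟩ := exists_final_of_picking (M := M) R
        {e | e ∈ M.edgeSet ∧ ∀ x ∈ e, x ∈ R} S fun e he => he.1
      exact ⟨c', S', .head (.switch h) h1, h2⟩
    · push Not at h
      obtain ⟨w, hwR, hw⟩ := h
      obtain ⟨hwM, u, v, huv, hwu, hwv⟩ := hw
      have huR : u ∈ R := by
        by_contra hu
        obtain ⟨w', hw', hw'R, hw'u, hw'v⟩ := hI.triangle u v huv hu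
        obtain rfl := hM.three hwM hw'.1 hwu huv hw'v.symm
        exact hw'R hwR
      have hlt : (R \ {w, u, v}).ncard < R.ncard := by
        refine Set.ncard_lt_ncard ⟨Set.sdiff_subset, fun hsub => ?_⟩
        exact (hsub hwR).2 (.inl rfl)
      obtain ⟨c', S', h1, h2⟩ := ih _ hlt _ _
        (hI.remove hM.isMatching ⟨hwM, u, v, huv, hwu, hwv⟩ huv hwR huR hwu hwv) rfl
      exact ⟨c', S', .head (.remove ⟨hwM, u, v, huv, hwu, hwv⟩ huv hwR huR
        (hI.mate_mem u v huv huR) hwu hwv) h1, h2⟩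

theorem Reachable.exists_final [Finite V] (hM : NoShortAugmentation G M) {c : Config G}
    (h : Reachable G M c) : ∃ (c' : Config G) (S : Set (V ⊕ G.edgeSet)),
      Relation.ReflTransGen (Step G M) c c' ∧ c'.IsFinal S := by
  have hI := h.inv hM
  cases c with
  | removing R S => exact exists_final_of_removing hM R S hI
  | picking R Q S => exact exists_final_of_picking R Q S hI.queue_subset

theorem Reachable.isGreedyCover (hM : NoShortAugmentation G M) {c : Config G}
    {S : Set (V ⊕ G.edgeSet)} (h : Reachable G M c) (hc : c.IsFinal S) : IsGreedyCover G M S := by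
  obtain ⟨R, rfl⟩ := hc
  exact PickingInv.isGreedyCover hM (h.inv hM)

end TotalCover

namespace RAM

/-! ### Programs with bounded loops -/

/-- The contents of the arrays. -/
abbrev Arrays := ℕ → ℕ → ℕ → ℕ

/-- The arrays after the entry `i`, `j` of the array `a` has been set to `k`. -/
def Arrays.set (A : Arrays) (a i j k : ℕ) : Arrays :=
  fun a' i' j' => if a' = a ∧ i' = i ∧ j' = j then k else A a' i' j'

/-- Programs that write to arrays only and in which every loop is a `for` loop up to the value of
the variable `0`. A `for` loop inside `d - 1` others has the loop variable `d`. -/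
inductive LoopProg
  | store (a : ℕ) (i j e : Expr)
  | seq (p q : LoopProg)
  | ifEq (e f : Expr) (p : LoopProg)
  | forLoop (p : LoopProg)

/-- `f 0`, …, `f (n - 1)` applied one after the other. -/
def iter {α : Type*} (f : ℕ → α → α) : ℕ → α → α
  | 0, a => a
  | n + 1, a => f n (iter f n a)

/-- All variables of the expression are less than `d`. -/
def Expr.Below (d : ℕ) : Expr → Prop
  | .const _ => True
  | .var x => x < d
  | .add e f => e.Below d ∧ f.Below d
  | .sub e f => e.Below d ∧ f.Below d
  | .read _ i j => i.Below d ∧ j.Below d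

theorem Expr.Below.eval_congr {d : ℕ} {e : Expr} (he : e.Below d) {s s' : State}
    (hv : ∀ x < d, s.var x = s'.var x) (ha : s.arr = s'.arr) : e.eval s = e.eval s' := by
  induction e with
  | const c => rfl
  | var x => exact hv x he
  | add e f ihe ihf => simp only [Expr.eval, ihe he.1, ihf he.2]
  | sub e f ihe ihf => simp only [Expr.eval, ihe he.1, ihf he.2]
  | read a i j ihi ihj => simp only [Expr.eval, ihi he.1, ihj he.2, ha]

namespace LoopProg

/-- Inside `d - 1` loops, the program uses the variable `0` and the loop variables only. -/
def WellScoped : ℕ → LoopProg → Prop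
  | d, store _ i j e => i.Below d ∧ j.Below d ∧ e.Below d
  | d, seq p q => p.WellScoped d ∧ q.WellScoped d
  | d, ifEq e f p => e.Below d ∧ f.Below d ∧ p.WellScoped d
  | d, forLoop p => p.WellScoped (d + 1)

/-- What the program does with the arrays, depending on the values of the variables. -/
def sem : LoopProg → ℕ → (ℕ → ℕ) → Arrays → Arrays
  | store a i j e, _, ρ, A => A.set a (i.eval ⟨ρ, A⟩) (j.eval ⟨ρ, A⟩) (e.eval ⟨ρ, A⟩)
  | seq p q, d, ρ, A => q.sem d ρ (p.sem d ρ A)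
  | ifEq e f p, d, ρ, A => if e.eval ⟨ρ, A⟩ = f.eval ⟨ρ, A⟩ then p.sem d ρ A else A
  | forLoop p, d, ρ, A => iter (fun i => p.sem (d + 1) (Function.update ρ d i)) (ρ 0) A

/-- The translation into programs of the random access machine. -/
def compile : ℕ → LoopProg → Prog
  | _, store a i j e => .store a i j e
  | d, seq p q => .seq (p.compile d) (q.compile d)
  | d, ifEq e f p => .ite (.add (.sub e f) (.sub f e)) .skip (p.compile d)
  | d, forLoop p => .seq (.assign d (.const 0)) (.loop (.sub (.var 0) (.var d))
      (.seq (p.compile (d + 1)) (.assign d (.add (.var d) (.const 1)))))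

/-- Induction on the program. A loop multiplies the bound of its body by the number of rounds, which
is always the value of variable `0`. Loop depth names the loop variables, so the body of a loop
leaves the counters of the enclosing loops, and its own, unchanged at its end. -/
theorem exists_runs_compile (p : LoopProg) (d : ℕ) (hd : 0 < d) (hp : p.WellScoped d) :
    ∃ B : Polynomial ℕ, ∀ (s : State) (ρ : ℕ → ℕ), (∀ x < d, s.var x = ρ x) →
      ∃ (k : ℕ) (s' : State), Runs (p.compile d) s k s' ∧ k ≤ B.eval (ρ 0) ∧
        s'.arr = p.sem d ρ s.arr ∧ ∀ x < d, s'.var x = ρ x := by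
  induction p generalizing d with
  | store a i j e =>
    refine ⟨.C (i.cost + j.cost + e.cost + 1), fun s ρ hs => ⟨_, _, .store a i j e s, ?_, ?_, hs⟩⟩
    · rw [Polynomial.eval_C]
    · simp only [State.setArr, sem]
      rw [hp.1.eval_congr (s' := ⟨ρ, s.arr⟩) hs rfl, hp.2.1.eval_congr (s' := ⟨ρ, s.arr⟩) hs rfl,
        hp.2.2.eval_congr (s' := ⟨ρ, s.arr⟩) hs rfl]
      rfl
  | seq p q ihp ihq =>
    obtain ⟨B, hB⟩ := ihp d hd hp.1
    obtain ⟨C, hC⟩ := ihq d hd hp.2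
    refine ⟨B + C, fun s ρ hs => ?_⟩
    obtain ⟨k, s', h1, h2, h3, h4⟩ := hB s ρ hs
    obtain ⟨l, s'', h5, h6, h7, h8⟩ := hC s' ρ h4
    refine ⟨_, _, .seq h1 h5, ?_, ?_, h8⟩
    · rw [Polynomial.eval_add]
      exact add_le_add h2 h6
    · rw [h7, h3, sem]
  | ifEq e f p ih =>
    obtain ⟨B, hB⟩ := ih d hd hp.2.2
    refine ⟨.C ((Expr.add (.sub e f) (.sub f e)).cost + 2) + B, fun s ρ hs => ?_⟩
    have he := hp.1.eval_congr (s' := ⟨ρ, s.arr⟩) hs rfl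
    have hf := hp.2.1.eval_congr (s' := ⟨ρ, s.arr⟩) hs rfl
    rw [Polynomial.eval_add, Polynomial.eval_C]
    by_cases h : e.eval ⟨ρ, s.arr⟩ = f.eval ⟨ρ, s.arr⟩
    · obtain ⟨k, s', h1, h2, h3, h4⟩ := hB s ρ hs
      refine ⟨_, _, .iteFalse ?_ h1, ?_, ?_, h4⟩
      · simp [Expr.eval, he, hf, h]
      · lia
      · rw [h3, sem, if_pos h]
    · refine ⟨_, _, .iteTrue ?_ (.skip s), ?_, ?_, hs⟩
      · simp only [Expr.eval, he, hf]
        lia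
      · lia
      · rw [sem, if_neg h]
  | forLoop p ih =>
    obtain ⟨B, hB⟩ := ih (d + 1) (Nat.succ_pos d) hp
    -- Each round costs 4 for the test and 4 for the increment besides the body. The 6 consists of 2
    -- for the initialisation and 4 for the final test.
    refine ⟨.X * (B + .C 8) + .C 6, fun s ρ hs => ?_⟩
    have hd0 : (0 : ℕ) ≠ d := hd.ne
    -- Here `i` rounds are done and `j` are left. The induction is on `j`, as the run of a loop is
    -- built from its first round.
    have key : ∀ (j i : ℕ) (s₁ : State), i + j = ρ 0 → (∀ x < d, s₁.var x = ρ x) → s₁.var d = i →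
        s₁.arr = iter (fun i => p.sem (d + 1) (Function.update ρ d i)) i s.arr →
        ∃ (k : ℕ) (s' : State), Runs (.loop (.sub (.var 0) (.var d))
          (.seq (p.compile (d + 1)) (.assign d (.add (.var d) (.const 1))))) s₁ k s' ∧
          k ≤ j * (B.eval (ρ 0) + 8) + 4 ∧
          s'.arr = iter (fun i => p.sem (d + 1) (Function.update ρ d i)) (ρ 0) s.arr ∧
          ∀ x < d, s'.var x = ρ x := by
      intro j
      induction j with
      | zero =>
        intro i s₁ hi h1 h2 h3
        refine ⟨_, _, .loopFalse ?_, ?_, ?_, h1⟩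
        · simp only [Expr.eval, h1 0 hd, h2]
          lia
        · simp [Expr.cost]
        · rw [h3, ← hi, add_zero]
      | succ j ihj =>
        intro i s₁ hi h1 h2 h3
        obtain ⟨k, s₂, r, hk, ha, hv⟩ := hB s₁ (Function.update ρ d i) (by
          intro x hx
          rcases Nat.lt_succ_iff_lt_or_eq.1 hx with hx | rfl
          · rw [Function.update_of_ne hx.ne, h1 x hx]
          · rw [Function.update_self, h2])
        rw [Function.update_of_ne hd0] at hk
        have hvd := hv d (Nat.lt_succ_self d)
        rw [Function.update_self] at hvd
        obtain ⟨l, s₃, r', hl, ha', hv'⟩ := ihj (i + 1)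
          (s₂.setVar d ((Expr.add (.var d) (.const 1)).eval s₂)) (by lia) (by
            intro x hx
            simp only [State.setVar, if_neg hx.ne]
            rw [hv x (hx.trans (Nat.lt_succ_self d)), Function.update_of_ne hx.ne])
          (by simp [State.setVar, Expr.eval, hvd])
          (by simp only [State.setVar, iter, ha, h3])
        refine ⟨_, _, .loopTrue ?_ (.seq r (.assign d _ s₂)) r', ?_, ha', hv'⟩
        · simp only [Expr.eval, h1 0 hd, h2]
          lia
        · simp only [Expr.cost]
          rw [add_one_mul]
          lia
    obtain ⟨k, s', r, hk, ha, hv⟩ := key (ρ 0) 0 (s.setVar d 0) (by lia) (by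
      intro x hx
      simp only [State.setVar, if_neg hx.ne, hs x hx]) (by simp [State.setVar]) rfl
    refine ⟨_, _, .seq (.assign d (.const 0) s) r, ?_, ha, hv⟩
    simp only [Expr.cost, Polynomial.eval_add, Polynomial.eval_mul, Polynomial.eval_X,
      Polynomial.eval_C]
    lia

/-- The program `p`, to be executed if all pairs of expressions in the list have equal values. -/
def guard (l : List (Expr × Expr)) (p : LoopProg) : LoopProg :=
  l.foldr (fun c q => ifEq c.1 c.2 q) p

end LoopProg

end RAM

/-! ### Iterating inflating maps -/

namespace RAM

theorem iter_induction {α : Type*} {f : ℕ → α → α} {P : ℕ → α → Prop} {a : α} {n : ℕ} (h0 : P 0 a)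
    (hs : ∀ i < n, ∀ a, P i a → P (i + 1) (f i a)) : P n (iter f n a) := by
  induction n with
  | zero => exact h0
  | succ n ih => exact hs n (Nat.lt_succ_self n) _ (ih fun i hi => hs i (hi.trans (Nat.lt_succ_self n)))

/-- The map `f` preserves `I` and moves points of `I` only by increasing the potential `φ`. -/
def Inflating {α : Type*} (I : α → Prop) (φ : α → ℕ) (f : α → α) : Prop :=
  ∀ a, I a → I (f a) ∧ (f a = a ∨ φ a < φ (f a))

namespace Inflating

variable {α : Type*} {I : α → Prop} {φ : α → ℕ}

theorem le {f : α → α} (hf : Inflating I φ f) {a : α} (ha : I a) : φ a ≤ φ (f a) := by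
  rcases (hf a ha).2 with h | h
  · rw [h]
  · exact h.le

theorem comp {f g : α → α} (hg : Inflating I φ g) (hf : Inflating I φ f) :
    Inflating I φ fun a => g (f a) := by
  intro a ha
  refine ⟨(hg _ (hf a ha).1).1, ?_⟩
  rcases (hf a ha).2 with h | h
  · simp only [h]
    exact (hg a ha).2
  · exact .inr (h.trans_le (hg.le (hf a ha).1))

/-- If `f` moved `a`, the potential would rise strictly, and `g` could not bring it back. -/
theorem fixed_of_comp {f g : α → α} (hg : Inflating I φ g) (hf : Inflating I φ f) {a : α} (ha : I a)
    (h : g (f a) = a) : f a = a ∧ g a = a := by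
  rcases (hf a ha).2 with h' | h'
  · exact ⟨h', by rwa [h'] at h⟩
  · have := hg.le (hf a ha).1
    rw [h] at this
    lia

theorem iter {f : ℕ → α → α} (hf : ∀ i, Inflating I φ (f i)) (n : ℕ) :
    Inflating I φ (iter f n) := by
  induction n with
  | zero => exact fun a ha => ⟨ha, .inl rfl⟩
  | succ n ih => exact (hf n).comp ih

/-- This is what makes a fruitless search informative: if the whole loop changes nothing, then no
single attempt in it does. -/
theorem fixed_of_iter {f : ℕ → α → α} (hf : ∀ i, Inflating I φ (f i)) {n : ℕ} {a : α} (ha : I a)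
    (h : RAM.iter f n a = a) : ∀ i < n, f i a = a := by
  induction n with
  | zero => exact fun i hi => absurd hi (Nat.not_lt_zero i)
  | succ n ih =>
    have := (hf n).fixed_of_comp (Inflating.iter hf n) ha h
    intro i hi
    rcases Nat.lt_succ_iff_lt_or_eq.1 hi with hi | rfl
    · exact ih this.1 i hi
    · exact this.2

/-- If the potential is at most `n`, then a fixed point is reached after `n` rounds. -/
theorem iter_fixed {f : α → α} (hf : Inflating I φ f) {n : ℕ} (hn : ∀ a, I a → φ a ≤ n) {a : α}
    (ha : I a) : I (RAM.iter (fun _ => f) n a) ∧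
      f (RAM.iter (fun _ => f) n a) = RAM.iter (fun _ => f) n a := by
  have hI := fun k => (Inflating.iter (fun _ => hf) k a ha).1
  -- Until a fixed point is reached, each round raises the potential by at least 1.
  have key : ∀ k, f (RAM.iter (fun _ => f) k a) = RAM.iter (fun _ => f) k a ∨
      k ≤ φ (RAM.iter (fun _ => f) k a) := by
    intro k
    induction k with
    | zero => exact .inr (Nat.zero_le _)
    | succ k ih =>
      simp only [RAM.iter]
      rcases (hf _ (hI k)).2 with h | h
      · left
        rw [h, h]
      · rcases ih with h' | h'
        · rw [h'] at h
          exact absurd h (lt_irrefl _)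
        · right
          lia
  refine ⟨hI n, ?_⟩
  rcases key n with h | h
  · exact h
  · refine (hf _ (hI n)).2.resolve_right fun h' => ?_
    have := hn _ (hf _ (hI n)).1
    lia

end Inflating

/-! ### Augmenting along paths of length 1, 3 and 5

The array `3` holds the matching: the entry of `v` is `0` if `v` is unmatched, and `w + 1` if `v` is
matched with `w`. -/

namespace Arrays

/-- Match `x` and `y`. -/
def link (A : Arrays) (x y : ℕ) : Arrays := (A.set 3 x 0 (y + 1)).set 3 y 0 (x + 1)

/-- Augment along the path `a`, `b`. -/
def augmentOne (a b : ℕ) (A : Arrays) : Arrays :=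
  if A 0 a b = 1 ∧ A 3 a 0 = 0 ∧ A 3 b 0 = 0 then A.link a b else A

/-- Augment along the path `a`, `b`, `c`, `d`. -/
def augmentThree (a b c d : ℕ) (A : Arrays) : Arrays :=
  if A 0 a b = 1 ∧ A 3 b 0 = c + 1 ∧ A 0 c d = 1 ∧ A 3 a 0 = 0 ∧ A 3 d 0 = 0 ∧
    1 - ((a - d) + (d - a)) = 0 then (A.link a b).link c d else A

/-- Augment along the path `a`, `b`, `c`, `d`, `e`, `f`. -/
def augmentFive (a b c d e f : ℕ) (A : Arrays) : Arrays :=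
  if A 0 a b = 1 ∧ A 3 b 0 = c + 1 ∧ A 0 c d = 1 ∧ A 3 d 0 = e + 1 ∧ A 0 e f = 1 ∧ A 3 a 0 = 0 ∧
    A 3 f 0 = 0 ∧ 1 - ((a - f) + (f - a)) = 0 ∧ 1 - ((b - d) + (d - b)) = 0 then
    ((A.link a b).link c d).link e f else A

/-- One round of the search for augmenting paths. -/
def augmentRound (n : ℕ) : Arrays → Arrays :=
  iter (fun a => iter (fun b => iter (fun c => iter (fun d => iter (fun e => iter (fun f A =>
    augmentFive a b c d e f (augmentThree a b c d (augmentOne a b A))) n) n) n) n) n) n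

theorem link_mate (A : Arrays) (x y v : ℕ) :
    A.link x y 3 v 0 = if v = y then x + 1 else if v = x then y + 1 else A 3 v 0 := by
  simp [link, set]

theorem link_of_ne (A : Arrays) (x y : ℕ) {a : ℕ} (ha : a ≠ 3) : A.link x y a = A a := by
  funext i j
  simp [link, set, ha]

/-- The array `3` holds a matching of `G`; the arrays for the output and for flags are empty. -/
structure IsMatchingOf {n : ℕ} (G : SimpleGraph (Fin n)) (A : Arrays) : Prop where
  adj : ∀ i j, A 0 i j = 1 ↔ ∃ (hi : i < n) (hj : j < n), G.Adj ⟨i, hi⟩ ⟨j, hj⟩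
  mate : ∀ u v, A 3 u 0 = v + 1 → A 0 u v = 1 ∧ A 3 v 0 = u + 1
  one : A 1 = 0
  two : A 2 = 0
  four : A 4 = 0

namespace IsMatchingOf

variable {n : ℕ} {G : SimpleGraph (Fin n)} {A A' : Arrays}

theorem symm (h : IsMatchingOf G A) {i j : ℕ} (hij : A 0 i j = 1) : A 0 j i = 1 := by
  rw [h.adj] at hij ⊢
  obtain ⟨hi, hj, hij⟩ := hij
  exact ⟨hj, hi, hij.symm⟩

theorem irrefl (h : IsMatchingOf G A) (i : ℕ) : A 0 i i ≠ 1 := by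
  rw [Ne, h.adj]
  rintro ⟨hi, _, hij⟩
  exact hij.ne rfl

theorem left_lt (h : IsMatchingOf G A) {i j : ℕ} (hij : A 0 i j = 1) : i < n :=
  ((h.adj i j).1 hij).1

/-- The number of matched vertices. -/
def size (n : ℕ) (A : Arrays) : ℕ := ((Finset.range n).filter fun v => A 3 v 0 ≠ 0).card

theorem size_le (n : ℕ) (A : Arrays) : size n A ≤ n :=
  (Finset.card_filter_le _ _).trans (Finset.card_range n).le

theorem size_lt_size {a : ℕ} (ha : a < n) (haA : A 3 a 0 = 0) (haA' : A' 3 a 0 ≠ 0)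
    (h : ∀ v, A 3 v 0 ≠ 0 → A' 3 v 0 ≠ 0) : size n A < size n A' := by
  refine Finset.card_lt_card (Finset.ssubset_iff_of_subset ?_ |>.2 ⟨a, ?_, ?_⟩)
  · exact Finset.monotone_filter_right _ fun v _ => h v
  · simp [ha, haA']
  · simp [haA]

theorem of_mate (h : IsMatchingOf G A) (hA : ∀ a ≠ 3, A' a = A a)
    (hm : ∀ u v, A' 3 u 0 = v + 1 → A 0 u v = 1 ∧ A' 3 v 0 = u + 1) : IsMatchingOf G A' where
  adj i j := by rw [hA 0 (by decide), h.adj]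
  mate u v := by
    rw [hA 0 (by decide)]
    exact hm u v
  one := by rw [hA 1 (by decide), h.one]
  two := by rw [hA 2 (by decide), h.two]
  four := by rw [hA 4 (by decide), h.four]

/-- Augmenting keeps every matched vertex matched and also matches `a`, so the number of matched
vertices serves as potential. -/
theorem inflating_augmentOne (a b : ℕ) : Inflating (IsMatchingOf G) (size n) (augmentOne a b) := by
  intro A h
  rw [augmentOne]
  split_ifs with hc
  swap
  · exact ⟨h, .inl rfl⟩
  obtain ⟨hab, ha, hb⟩ := hc
  have hne : a ≠ b := fun e => h.irrefl a (by rwa [← e] at hab)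
  have hba := h.symm hab
  refine ⟨h.of_mate (fun x hx => link_of_ne _ _ _ hx) ?_, .inr ?_⟩
  · intro u v
    have := h.mate u v
    simp only [link_mate]
    grind
  · refine size_lt_size (h.left_lt hab) ha ?_ ?_
    · rw [link_mate]
      grind
    · intro v
      rw [link_mate]
      grind

theorem inflating_augmentThree (a b c d : ℕ) :
    Inflating (IsMatchingOf G) (size n) (augmentThree a b c d) := by
  intro A h
  rw [augmentThree]
  split_ifs with hc
  swap
  · exact ⟨h, .inl rfl⟩
  obtain ⟨hab, hb, hcd, ha, hd, had⟩ := hc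
  have hne : a ≠ b := fun e => h.irrefl a (by rwa [← e] at hab)
  have hne' : c ≠ d := fun e => h.irrefl c (by rwa [← e] at hcd)
  have hbc : b ≠ c := fun e => h.irrefl b (by simpa [← e] using (h.mate b c hb).1)
  -- With truncated subtraction, the tested term is 1 if `a = d` and 0 otherwise.
  replace had : a ≠ d := by lia
  have hba := h.symm hab
  have hdc := h.symm hcd
  have hc := (h.mate b c hb).2
  refine ⟨h.of_mate (fun x hx => ?_) ?_, .inr ?_⟩
  · simp only [link_of_ne _ _ _ hx]
  · intro u v
    have := h.mate u v
    simp only [link_mate]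
    grind
  · refine size_lt_size (h.left_lt hab) ha ?_ ?_
    · simp only [link_mate]
      grind
    · intro v
      simp only [link_mate]
      grind

theorem inflating_augmentFive (a b c d e f : ℕ) :
    Inflating (IsMatchingOf G) (size n) (augmentFive a b c d e f) := by
  intro A h
  rw [augmentFive]
  split_ifs with hc
  swap
  · exact ⟨h, .inl rfl⟩
  obtain ⟨hab, hb, hcd, hd, hef, ha, hf, haf, hbd⟩ := hc
  have hne : a ≠ b := fun e => h.irrefl a (by rwa [← e] at hab)
  have hne' : c ≠ d := fun e => h.irrefl c (by rwa [← e] at hcd)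
  have hne'' : e ≠ f := fun e' => h.irrefl e (by rwa [← e'] at hef)
  have hbc : b ≠ c := fun e => h.irrefl b (by simpa [← e] using (h.mate b c hb).1)
  have hde : d ≠ e := fun e' => h.irrefl d (by simpa [← e'] using (h.mate d e hd).1)
  replace haf : a ≠ f := by lia
  replace hbd : b ≠ d := by lia
  have hba := h.symm hab
  have hdc := h.symm hcd
  have hfe := h.symm hef
  have hc := (h.mate b c hb).2
  have he := (h.mate d e hd).2
  refine ⟨h.of_mate (fun x hx => ?_) ?_, .inr ?_⟩
  · simp only [link_of_ne _ _ _ hx]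
  · intro u v
    have := h.mate u v
    simp only [link_mate]
    grind (splits := 20)
  · refine size_lt_size (h.left_lt hab) ha ?_ ?_
    · simp only [link_mate]
      grind
    · intro v
      simp only [link_mate]
      grind

theorem inflating_augment (a b c d e f : ℕ) : Inflating (IsMatchingOf G) (size n)
    fun A => augmentFive a b c d e f (augmentThree a b c d (augmentOne a b A)) :=
  (inflating_augmentFive a b c d e f).comp
    ((inflating_augmentThree a b c d).comp (inflating_augmentOne a b))

theorem inflating_augmentRound : Inflating (IsMatchingOf G) (size n) (augmentRound n) :=
  .iter (fun _ => .iter (fun _ => .iter (fun _ => .iter (fun _ => .iter (fun _ => .iter (fun _ =>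
    inflating_augment _ _ _ _ _ _) _) _) _) _) _) _

theorem fixed_of_augmentRound (h : IsMatchingOf G A) (hA : augmentRound n A = A) {a b c d e f : ℕ}
    (ha : a < n) (hb : b < n) (hc : c < n) (hd : d < n) (he : e < n) (hf : f < n) :
    augmentOne a b A = A ∧ augmentThree a b c d A = A ∧ augmentFive a b c d e f A = A := by
  have h1 := Inflating.fixed_of_iter (fun _ => .iter (fun _ => .iter (fun _ => .iter (fun _ => .iter
    (fun _ => .iter (fun _ => inflating_augment _ _ _ _ _ _) _) _) _) _) _) h hA a ha
  have h2 := Inflating.fixed_of_iter (fun _ => .iter (fun _ => .iter (fun _ => .iter (fun _ => .iter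
    (fun _ => inflating_augment _ _ _ _ _ _) _) _) _) _) h h1 b hb
  have h3 := Inflating.fixed_of_iter (fun _ => .iter (fun _ => .iter (fun _ => .iter (fun _ =>
    inflating_augment _ _ _ _ _ _) _) _) _) h h2 c hc
  have h4 := Inflating.fixed_of_iter (fun _ => .iter (fun _ => .iter (fun _ =>
    inflating_augment _ _ _ _ _ _) _) _) h h3 d hd
  have h5 := Inflating.fixed_of_iter (fun _ => .iter (fun _ =>
    inflating_augment _ _ _ _ _ _) _) h h4 e he
  have h6 := Inflating.fixed_of_iter (fun _ => inflating_augment _ _ _ _ _ _) h h5 f hf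
  have h7 := (inflating_augmentFive a b c d e f).fixed_of_comp
    ((inflating_augmentThree a b c d).comp (inflating_augmentOne a b)) h h6
  have h8 := (inflating_augmentThree a b c d).fixed_of_comp (inflating_augmentOne a b) h h7.1
  exact ⟨h8.1, h8.2, h7.2⟩

/-- The matching held in the array `3`. -/
def subgraph (h : IsMatchingOf G A) : G.Subgraph where
  verts := {u | A 3 u 0 ≠ 0}
  Adj u v := A 3 u 0 = v + 1
  adj_sub {u v} huv := ((h.adj u v).1 (h.mate u v huv).1).2.2
  edge_vert {u v} huv := by simp [huv]
  symm := ⟨fun u v huv => (h.mate u v huv).2⟩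

theorem adj_iff (h : IsMatchingOf G A) (u v : Fin n) : A 0 u v = 1 ↔ G.Adj u v := by
  rw [h.adj]
  exact ⟨fun h => h.2.2, fun h => ⟨u.2, v.2, h⟩⟩

/-- Along an augmenting path the corresponding attempt would give the last vertex a mate, whereas at
a fixed point that vertex stays unmatched. -/
theorem noShortAugmentation (h : IsMatchingOf G A) (hA : augmentRound n A = A) :
    TotalCover.NoShortAugmentation G h.subgraph where
  isMatching := by
    intro u hu
    obtain ⟨w, hw⟩ := Nat.exists_eq_succ_of_ne_zero hu
    have hwn : w < n := ((h.adj u w).1 (h.mate u w hw).1).2.1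
    refine ⟨⟨w, hwn⟩, hw, fun y hy => ?_⟩
    have hy' : A 3 u 0 = y + 1 := hy
    ext
    simp only
    lia
  one := by
    intro a b ha hb hab
    rw [← h.adj_iff] at hab
    have ha : A 3 a 0 = 0 := not_not.1 ha
    have hb : A 3 b 0 = 0 := not_not.1 hb
    -- A path of length 1 uses the first two indices only, so `a` fills the other places.
    have := (fixed_of_augmentRound h hA a.2 b.2 a.2 a.2 a.2 a.2).1
    rw [augmentOne, if_pos ⟨hab, ha, hb⟩] at this
    have h' := congrArg (fun A : Arrays => A 3 b 0) this
    simp [link_mate, hb] at h'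
  three := by
    intro a b c d ha hd hab hbc hcd
    by_contra had
    have had' : (a : ℕ) ≠ d := fun e => had (Fin.ext e)
    rw [← h.adj_iff] at hab hcd
    have ha : A 3 a 0 = 0 := not_not.1 ha
    have hd : A 3 d 0 = 0 := not_not.1 hd
    have := (fixed_of_augmentRound h hA a.2 b.2 c.2 d.2 a.2 a.2).2.1
    rw [augmentThree, if_pos ⟨hab, hbc, hcd, ha, hd, by lia⟩] at this
    have h' := congrArg (fun A : Arrays => A 3 d 0) this
    simp [link_mate, hd] at h'
  five := by
    intro a b c d e f ha hf hab hbc hcd hde hef hbd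
    by_contra haf
    have haf' : (a : ℕ) ≠ f := fun e => haf (Fin.ext e)
    have hbd' : (b : ℕ) ≠ d := fun e => hbd (Fin.ext e)
    rw [← h.adj_iff] at hab hcd hef
    have ha : A 3 a 0 = 0 := not_not.1 ha
    have hf : A 3 f 0 = 0 := not_not.1 hf
    have := (fixed_of_augmentRound h hA a.2 b.2 c.2 d.2 e.2 f.2).2.2
    rw [augmentFive, if_pos ⟨hab, hbc, hcd, hde, hef, ha, hf, by lia, by lia⟩] at this
    have h' := congrArg (fun A : Arrays => A 3 f 0) this
    simp [link_mate, hf] at h'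

end IsMatchingOf

end Arrays

end RAM

namespace RAM

/-! ### From the matching to the cover

The array `1` flags the vertices of the cover, the array `2` its edges, and the array `4` the
vertices that have been found to have a neighbour in the cover. -/

namespace Arrays

/-- Flag the bad vertices. -/
def markBad (n : ℕ) : Arrays → Arrays :=
  iter (fun w => iter (fun u A => if A 3 w 0 = 0 ∧ A 0 w u = 1 ∧ 1 - A 3 u 0 = 0 ∧
    A 0 w (A 3 u 0 - 1) = 1 then A.set 1 w 0 1 else A) n) n

/-- Record whether `z` has a flagged neighbour. -/
def checkNeighbours (n z : ℕ) : Arrays → Arrays :=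
  iter (fun u A => if A 0 z u = 1 ∧ A 1 u 0 = 1 then A.set 4 z 0 1 else A) n

/-- Flag a neighbour of `z` if `z` is unmatched, not flagged, and has no flagged neighbour. -/
def flagNeighbour (n z : ℕ) : Arrays → Arrays :=
  iter (fun u A => if A 3 z 0 = 0 ∧ A 1 z 0 = 0 ∧ A 0 z u = 1 ∧ A 4 z 0 = 0 then
    (A.set 1 u 0 1).set 4 z 0 1 else A) n

/-- Flag `z` if it is unmatched, not flagged, and has no flagged neighbour. -/
def flagVertex (z : ℕ) (A : Arrays) : Arrays :=
  if A 3 z 0 = 0 ∧ A 1 z 0 = 0 ∧ A 4 z 0 = 0 then A.set 1 z 0 1 else A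

/-- Flag vertices so that every unmatched vertex is flagged or has a flagged neighbour. -/
def dominate (n : ℕ) : Arrays → Arrays :=
  iter (fun z A => flagVertex z (flagNeighbour n z (checkNeighbours n z A))) n

/-- Put the matching edges without flagged ends into the cover. -/
def emitEdges (n : ℕ) : Arrays → Arrays :=
  iter (fun u => iter (fun v A => if A 3 u 0 = v + 1 ∧ A 1 u 0 = 0 ∧ A 1 v 0 = 0 then
    A.set 2 u v 1 else A) n) n

theorem set_apply_of_ne (A : Arrays) {a b : ℕ} (i j k : ℕ) (h : b ≠ a) : A.set a i j k b = A b := by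
  funext x y
  simp [set, h]

theorem set_apply_zero (A : Arrays) (a i k x : ℕ) :
    A.set a i 0 k a x 0 = if x = i then k else A a x 0 := by
  simp [set]

/-- Only the array `1` is written while the tests read the arrays `0` and `3`, so the tests can be
evaluated in the initial arrays. The mate is decoded by subtracting 1. The nonzero clause is needed
because truncated subtraction would turn an unmatched `u` into one with mate `0`. -/
theorem markBad_spec (n : ℕ) (A : Arrays) (hA : A 1 = 0) : (∀ a ≠ 1, markBad n A a = A a) ∧
    (∀ x, markBad n A 1 x 0 ≤ 1) ∧ ∀ x, markBad n A 1 x 0 = 1 ↔ x < n ∧ ∃ u < n,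
      A 3 x 0 = 0 ∧ A 0 x u = 1 ∧ A 3 u 0 ≠ 0 ∧ A 0 x (A 3 u 0 - 1) = 1 := by
  refine iter_induction (P := fun i (A' : Arrays) => (∀ a ≠ 1, A' a = A a) ∧ (∀ x, A' 1 x 0 ≤ 1) ∧
    ∀ x, A' 1 x 0 = 1 ↔ x < i ∧ ∃ u < n,
      A 3 x 0 = 0 ∧ A 0 x u = 1 ∧ A 3 u 0 ≠ 0 ∧ A 0 x (A 3 u 0 - 1) = 1) ?_ ?_
  · simp [hA]
  · rintro w - A₁ ⟨h1, h2, h3⟩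
    have := iter_induction (n := n) (a := A₁) (f := fun u A => if A 3 w 0 = 0 ∧ A 0 w u = 1 ∧
      1 - A 3 u 0 = 0 ∧ A 0 w (A 3 u 0 - 1) = 1 then A.set 1 w 0 1 else A)
      (P := fun j (A' : Arrays) => (∀ a ≠ 1, A' a = A a) ∧ (∀ x, A' 1 x 0 ≤ 1) ∧
        ∀ x, A' 1 x 0 = 1 ↔ A₁ 1 x 0 = 1 ∨ x = w ∧ ∃ u < j,
          A 3 x 0 = 0 ∧ A 0 x u = 1 ∧ A 3 u 0 ≠ 0 ∧ A 0 x (A 3 u 0 - 1) = 1) ?_ ?_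
    · refine ⟨this.1, this.2.1, fun x => ?_⟩
      rw [this.2.2, h3]
      grind
    · exact ⟨h1, h2, by simp⟩
    · rintro u - A₂ ⟨h4, h5, h6⟩
      simp only [h4 3 (by decide), h4 0 (by decide)]
      split_ifs with hc
      · refine ⟨fun a ha => ?_, fun x => ?_, fun x => ?_⟩
        · rw [set_apply_of_ne _ _ _ _ ha, h4 a ha]
        · rw [set_apply_zero]
          grind
        · rw [set_apply_zero]
          grind
      · refine ⟨h4, h5, fun x => ?_⟩
        rw [h6]
        grind

theorem checkNeighbours_spec (n z : ℕ) (A : Arrays) (hA : A 4 z 0 = 0) :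
    (∀ a ≠ 4, checkNeighbours n z A a = A a) ∧
    (∀ x ≠ z, checkNeighbours n z A 4 x 0 = A 4 x 0) ∧
    (checkNeighbours n z A 4 z 0 = 0 ↔ ∀ u < n, A 0 z u = 1 → A 1 u 0 ≠ 1) := by
  refine iter_induction (P := fun i (A' : Arrays) => (∀ a ≠ 4, A' a = A a) ∧
    (∀ x ≠ z, A' 4 x 0 = A 4 x 0) ∧
    (A' 4 z 0 = 0 ↔ ∀ u < i, A 0 z u = 1 → A 1 u 0 ≠ 1)) ?_ ?_
  · simp [hA]
  · rintro u - A₁ ⟨h1, h2, h3⟩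
    simp only [h1 1 (by decide), h1 0 (by decide)]
    split_ifs with hc
    · refine ⟨fun a ha => ?_, fun x hx => ?_, ?_⟩
      · rw [set_apply_of_ne _ _ _ _ ha, h1 a ha]
      · rw [set_apply_zero, if_neg hx, h2 x hx]
      · rw [set_apply_zero]
        grind
    · refine ⟨h1, h2, ?_⟩
      rw [h3]
      grind

/-- Flagging a neighbour also sets the entry of `z` in the array `4`, which disables the rest of the
loop. So at most one neighbour is flagged. -/
theorem flagNeighbour_spec (n z : ℕ) (A : Arrays) (hz : A 0 z z ≠ 1) :
    (∀ a ≠ 1, a ≠ 4 → flagNeighbour n z A a = A a) ∧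
    (∀ x ≠ z, flagNeighbour n z A 4 x 0 = A 4 x 0) ∧
    ((flagNeighbour n z A = A ∧
      (A 3 z 0 = 0 → A 1 z 0 = 0 → A 4 z 0 = 0 → ∀ u < n, A 0 z u ≠ 1)) ∨
     (A 3 z 0 = 0 ∧ A 1 z 0 = 0 ∧ A 4 z 0 = 0 ∧ flagNeighbour n z A 4 z 0 = 1 ∧
      ∃ u < n, A 0 z u = 1 ∧
        ∀ x, flagNeighbour n z A 1 x 0 = if x = u then 1 else A 1 x 0)) := by
  refine iter_induction (P := fun i (A' : Arrays) => (∀ a ≠ 1, a ≠ 4 → A' a = A a) ∧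
    (∀ x ≠ z, A' 4 x 0 = A 4 x 0) ∧
    ((A' = A ∧ (A 3 z 0 = 0 → A 1 z 0 = 0 → A 4 z 0 = 0 → ∀ u < i, A 0 z u ≠ 1)) ∨
     (A 3 z 0 = 0 ∧ A 1 z 0 = 0 ∧ A 4 z 0 = 0 ∧ A' 4 z 0 = 1 ∧
      ∃ u < n, A 0 z u = 1 ∧ ∀ x, A' 1 x 0 = if x = u then 1 else A 1 x 0))) ?_ ?_
  · simp
  · rintro u hu A₁ ⟨h1, h2, ⟨rfl, h3⟩ | h3⟩
    · split_ifs with hc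
      · refine ⟨fun a ha ha' => ?_, fun x hx => ?_, .inr ⟨hc.1, hc.2.1, hc.2.2.2, ?_, u, hu, hc.2.2.1,
          fun x => ?_⟩⟩
        · rw [set_apply_of_ne _ _ _ _ ha', set_apply_of_ne _ _ _ _ ha]
        · rw [set_apply_zero, if_neg hx, set_apply_of_ne _ _ _ _ (by decide)]
        · rw [set_apply_zero, if_pos rfl]
        · rw [set_apply_of_ne _ _ _ _ (by decide), set_apply_zero]
      · refine ⟨h1, h2, .inl ⟨rfl, ?_⟩⟩
        grind
    · rw [if_neg (by simp [h3.2.2.2.1])]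
      exact ⟨h1, h2, .inr h3⟩

theorem emitEdges_spec (n : ℕ) (A : Arrays) (hA : A 2 = 0) : (∀ a ≠ 2, emitEdges n A a = A a) ∧
    ∀ x y, emitEdges n A 2 x y ≠ 0 ↔
      x < n ∧ y < n ∧ A 3 x 0 = y + 1 ∧ A 1 x 0 = 0 ∧ A 1 y 0 = 0 := by
  refine iter_induction (P := fun i (A' : Arrays) => (∀ a ≠ 2, A' a = A a) ∧
    ∀ x y, A' 2 x y ≠ 0 ↔ x < i ∧ y < n ∧ A 3 x 0 = y + 1 ∧ A 1 x 0 = 0 ∧ A 1 y 0 = 0) ?_ ?_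
  · simp [hA]
  · rintro u - A₁ ⟨h1, h2⟩
    have := iter_induction (n := n) (a := A₁) (f := fun v A =>
      if A 3 u 0 = v + 1 ∧ A 1 u 0 = 0 ∧ A 1 v 0 = 0 then A.set 2 u v 1 else A)
      (P := fun j (A' : Arrays) => (∀ a ≠ 2, A' a = A a) ∧ ∀ x y, A' 2 x y ≠ 0 ↔ A₁ 2 x y ≠ 0 ∨
        x = u ∧ y < j ∧ A 3 x 0 = y + 1 ∧ A 1 x 0 = 0 ∧ A 1 y 0 = 0) ?_ ?_
    · refine ⟨this.1, fun x y => ?_⟩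
      rw [this.2, h2]
      grind
    · exact ⟨h1, by simp⟩
    · rintro v - A₂ ⟨h4, h5⟩
      simp only [h4 3 (by decide), h4 1 (by decide)]
      split_ifs with hc
      · refine ⟨fun a ha => ?_, fun x y => ?_⟩
        · rw [set_apply_of_ne _ _ _ _ ha, h4 a ha]
        · have : A₂.set 2 u v 1 2 x y = if x = u ∧ y = v then 1 else A₂ 2 x y := by simp [set]
          rw [this]
          grind
      · refine ⟨h4, fun x y => ?_⟩
        rw [h5]
        grind

/-! ### The output is a greedy cover -/

open TotalCover

variable {n : ℕ} {G : SimpleGraph (Fin n)} {A : Arrays}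

/-- What holds after the vertices less than `i` have been dealt with by `dominate`. -/
structure DominateInv (G : SimpleGraph (Fin n)) (M : G.Subgraph) (A : Arrays) (i : ℕ)
    (A' : Arrays) : Prop where
  same : ∀ a ≠ 1, a ≠ 4 → A' a = A a
  four : ∀ x ≥ i, A' 4 x 0 = 0
  le_one : ∀ x, A' 1 x 0 ≤ 1
  unmatched : ∀ v ∉ M.verts, A' 1 v 0 = 1 ↔ (v : ℕ) < i ∧ v ∈ isolated G ∨ v ∈ bad G M
  witness : ∀ u ∈ M.verts, A' 1 u 0 = 1 → ∃ z ∉ M.verts, z ∉ bad G M ∧ G.Adj u z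
  witness_pair : ∀ u ∈ M.verts, ∀ u' ∈ M.verts, A' 1 u 0 = 1 → A' 1 u' 0 = 1 → u ≠ u' →
    ∃ z ∉ M.verts, ∃ z' ∉ M.verts, G.Adj u z ∧ G.Adj u' z' ∧ z ≠ z'
  dominated : ∀ z ∉ M.verts, (z : ℕ) < i → z ∉ bad G M → z ∉ isolated G →
    ∃ u, G.Adj z u ∧ A' 1 u 0 = 1

theorem IsMatchingOf.not_mem_verts (h : IsMatchingOf G A) (u : Fin n) :
    u ∉ h.subgraph.verts ↔ A 3 u 0 = 0 := not_not

theorem IsMatchingOf.dominateInv_markBad (h : IsMatchingOf G A) :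
    DominateInv G h.subgraph A 0 (markBad n A) := by
  obtain ⟨h1, h2, h3⟩ := markBad_spec n A h.one
  constructor
  · exact fun a ha _ => h1 a ha
  · intro x _
    rw [h1 4 (by decide), h.four]
    rfl
  · exact h2
  · intro v hv
    rw [h3]
    simp only [Nat.not_lt_zero, false_and, false_or]
    constructor
    · rintro ⟨-, u, hu, -, h4, h5, h6⟩
      obtain ⟨w, hw⟩ := Nat.exists_eq_succ_of_ne_zero h5
      rw [hw, Nat.succ_sub_one] at h6
      have hwn := h.left_lt (h.symm h6)
      exact ⟨hv, ⟨u, hu⟩, ⟨w, hwn⟩, hw, (h.adj_iff v ⟨u, hu⟩).1 h4, (h.adj_iff v ⟨w, hwn⟩).1 h6⟩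
    · rintro ⟨-, u, w, huw, h4, h5⟩
      have huw : A 3 u 0 = w + 1 := huw
      refine ⟨v.2, u, u.2, (h.not_mem_verts v).1 hv, (h.adj_iff v u).2 h4, by lia, ?_⟩
      rw [huw, Nat.add_sub_cancel]
      exact (h.adj_iff v w).2 h5
  · intro u hu hu1
    obtain ⟨-, _, -, h4, -⟩ := (h3 u).1 hu1
    exact absurd h4 hu
  · intro u hu _ _ hu1
    obtain ⟨-, _, -, h4, -⟩ := (h3 u).1 hu1
    exact absurd h4 hu
  · intro z _ hz
    exact absurd hz (Nat.not_lt_zero _)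

/-- If a neighbour `u` of `z` gets flagged, then `z` is unmatched and had no flagged neighbour, so
it is a new witness, distinct from those of all earlier flagged matched vertices. It is not bad,
since bad vertices are flagged from the start, and `u` is matched because there is no augmenting
path of length 1. If no neighbour gets flagged and `z` itself does, then `z` is isolated. -/
theorem DominateInv.step (h : IsMatchingOf G A) (hM : NoShortAugmentation G h.subgraph) {i : ℕ}
    (hi : i < n) {A₁ : Arrays} (hA : DominateInv G h.subgraph A i A₁) :
    DominateInv G h.subgraph A (i + 1)
      (flagVertex i (flagNeighbour n i (checkNeighbours n i A₁))) := by
  obtain ⟨z, rfl⟩ : ∃ z : Fin n, (z : ℕ) = i := ⟨⟨i, hi⟩, rfl⟩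
  obtain ⟨c1, c2, c3⟩ := checkNeighbours_spec n z A₁ (hA.four z le_rfl)
  have hA3 : A₁ 3 = A 3 := hA.same 3 (by decide) (by decide)
  have hA0 : A₁ 0 = A 0 := hA.same 0 (by decide) (by decide)
  generalize checkNeighbours n z A₁ = A₂ at *
  have e3 : A₂ 3 = A 3 := by rw [c1 3 (by decide), hA3]
  have e0 : A₂ 0 = A 0 := by rw [c1 0 (by decide), hA0]
  have e1 : A₂ 1 = A₁ 1 := c1 1 (by decide)
  obtain ⟨f1, f2, f3⟩ := flagNeighbour_spec n z A₂ (by rw [e0]; exact h.irrefl z)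
  generalize flagNeighbour n z A₂ = A₃ at *
  rw [e3, e0, e1] at f3
  rw [hA0] at c3
  have g3 : A₃ 3 = A 3 := by rw [f1 3 (by decide) (by decide), e3]
  have four : ∀ x ≥ (z : ℕ) + 1, A₃ 4 x 0 = 0 := by
    intro x hx
    rw [f2 x (by lia), c2 x (by lia), hA.four x (by lia)]
  have same : ∀ a ≠ 1, a ≠ 4 → A₃ a = A a := by
    intro a ha ha'
    rw [f1 a ha ha', c1 a ha', hA.same a ha ha']
  have lt_succ : ∀ v : Fin n, (v : ℕ) < z + 1 ↔ (v : ℕ) < z ∨ v = z := by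
    intro v
    rw [Nat.lt_succ_iff_lt_or_eq, Fin.ext_iff]
  have no_nbr : A₂ 4 z 0 = 0 → ∀ u, G.Adj z u → A₁ 1 u 0 ≠ 1 := by
    intro h4 u hu
    exact c3.1 h4 u u.2 ((h.adj_iff z u).2 hu)
  rw [flagVertex, g3]
  rcases f3 with ⟨rfl, f3⟩ | ⟨m1, m2, m3, m4, u, hu, hzu, f3⟩
  · rw [e1]
    split_ifs with hc
    · have hiso : z ∈ isolated G := fun u hu => f3 hc.1 hc.2.1 hc.2.2 u u.2 ((h.adj_iff z u).2 hu)
      have hzM : z ∉ h.subgraph.verts := (h.not_mem_verts z).2 hc.1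
      have new : ∀ x : Fin n, A₃.set 1 z 0 1 1 x 0 = 1 ↔ x = z ∨ A₁ 1 x 0 = 1 := by
        intro x
        rw [set_apply_zero, e1, Fin.ext_iff]
        grind
      constructor
      · intro a ha ha'
        rw [set_apply_of_ne _ _ _ _ ha, same a ha ha']
      · intro x hx
        rw [set_apply_of_ne _ _ _ _ (by decide), four x hx]
      · intro x
        rw [set_apply_zero, e1]
        have := hA.le_one x
        grind
      · intro v hv
        rw [new, hA.unmatched v hv, lt_succ]
        grind
      · intro u hu hu1
        rcases (new u).1 hu1 with rfl | hu1
        · exact absurd hu hzM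
        · exact hA.witness u hu hu1
      · intro u hu u' hu' hu1 hu1' hne
        rcases (new u).1 hu1 with rfl | hu1
        · exact absurd hu hzM
        rcases (new u').1 hu1' with rfl | hu1'
        · exact absurd hu' hzM
        exact hA.witness_pair u hu u' hu' hu1 hu1' hne
      · intro x hx hxz hxb hxi
        rcases (lt_succ x).1 hxz with hxz | rfl
        · obtain ⟨u, hu, hu1⟩ := hA.dominated x hx hxz hxb hxi
          exact ⟨u, hu, (new u).2 (.inr hu1)⟩
        · exact absurd hiso hxi
    · constructor
      · exact same
      · exact four
      · rw [e1]
        exact hA.le_one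
      · intro v hv
        rw [e1, hA.unmatched v hv, lt_succ]
        constructor
        · tauto
        · rintro (⟨h1 | rfl, h2⟩ | h1)
          · exact .inl ⟨h1, h2⟩
          · exfalso
            have h4 : A₃ 4 v 0 = 0 :=
              c3.2 fun u hu huv => absurd ((h.adj_iff v ⟨u, hu⟩).1 huv) (h2 _)
            have h5 : A₁ 1 v 0 ≠ 1 := by
              rw [Ne, hA.unmatched v hv]
              rintro (h6 | ⟨-, u, -, -, h6, -⟩)
              · exact lt_irrefl _ h6.1
              · exact h2 u h6
            have h6 := hA.le_one v
            exact hc ⟨(h.not_mem_verts v).1 hv, by lia, h4⟩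
          · exact .inr h1
      · rw [e1]
        exact hA.witness
      · rw [e1]
        exact hA.witness_pair
      · intro x hx hxz hxb hxi
        rw [e1]
        rcases (lt_succ x).1 hxz with hxz | rfl
        · exact hA.dominated x hx hxz hxb hxi
        -- A vertex that is neither flagged nor dominated would have passed the test of
        -- `flagVertex`.
        · by_contra hcon
          have h4 : A₃ 4 x 0 = 0 :=
            c3.2 fun u hu huv hu1 => hcon ⟨⟨u, hu⟩, (h.adj_iff x ⟨u, hu⟩).1 huv, hu1⟩
          have h5 : A₁ 1 x 0 ≠ 1 := by
            rw [Ne, hA.unmatched x hx]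
            tauto
          have h6 := hA.le_one x
          exact hc ⟨(h.not_mem_verts x).1 hx, by lia, h4⟩
  · rw [if_neg (by simp [m4])]
    lift u to Fin n using hu
    rw [h.adj_iff] at hzu
    have hzM : z ∉ h.subgraph.verts := (h.not_mem_verts z).2 m1
    have huM : u ∈ h.subgraph.verts := by_contra fun h' => hM.one hzM h' hzu
    have hzb : z ∉ bad G h.subgraph := by
      intro hb
      have := (hA.unmatched z hzM).2 (.inr hb)
      lia
    have hzi : z ∉ isolated G := fun h' => h' u hzu
    have new : ∀ x : Fin n, A₃ 1 x 0 = 1 ↔ x = u ∨ A₁ 1 x 0 = 1 := by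
      intro x
      rw [f3, Fin.ext_iff]
      grind
    have key : ∀ x ∈ h.subgraph.verts, A₁ 1 x 0 = 1 →
        ∃ z' ∉ h.subgraph.verts, G.Adj x z' ∧ z ≠ z' := by
      intro x hx hx1
      obtain ⟨z', h1, -, h2⟩ := hA.witness x hx hx1
      refine ⟨z', h1, h2, ?_⟩
      rintro rfl
      exact no_nbr m3 x h2.symm hx1
    constructor
    · exact same
    · exact four
    · intro x
      rw [f3]
      have := hA.le_one x
      grind
    · intro v hv
      rw [new, hA.unmatched v hv, lt_succ]
      have : v ≠ u := by
        rintro rfl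
        exact hv huM
      grind
    · intro x hx hx1
      rcases (new x).1 hx1 with rfl | hx1
      · exact ⟨z, hzM, hzb, hzu.symm⟩
      · exact hA.witness x hx hx1
    · intro x hx y hy hx1 hy1 hne
      rcases (new x).1 hx1 with rfl | hx1 <;> rcases (new y).1 hy1 with rfl | hy1
      · exact absurd rfl hne
      · obtain ⟨z', h3, h4, h5⟩ := key y hy hy1
        exact ⟨z, hzM, z', h3, hzu.symm, h4, h5⟩
      · obtain ⟨z', h3, h4, h5⟩ := key x hx hx1
        exact ⟨z', h3, z, hzM, h4, hzu.symm, h5.symm⟩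
      · exact hA.witness_pair x hx y hy hx1 hy1 hne
    · intro x hx hxz hxb hxi
      rcases (lt_succ x).1 hxz with hxz | rfl
      · obtain ⟨u', hu', hu1⟩ := hA.dominated x hx hxz hxb hxi
        exact ⟨u', hu', (new u').2 (.inr hu1)⟩
      · exact ⟨u, hzu, (new u).2 (.inl rfl)⟩

theorem IsMatchingOf.isGreedyCover (h : IsMatchingOf G A) (hM : NoShortAugmentation G h.subgraph)
    {s : State} (hs : s.arr = emitEdges n (dominate n (markBad n A))) :
    IsGreedyCover G h.subgraph (output G s) := by
  have hD : DominateInv G h.subgraph A n (dominate n (markBad n A)) :=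
    iter_induction (P := DominateInv G h.subgraph A) h.dominateInv_markBad
      fun i hi _ hA => hA.step h hM hi
  generalize dominate n (markBad n A) = A₁ at *
  obtain ⟨h1, h2⟩ := emitEdges_spec n A₁ (by rw [hD.same 2 (by decide) (by decide), h.two])
  rw [← hs] at h1 h2
  rw [hD.same 3 (by decide) (by decide)] at h2
  have vertex : ∀ v : Fin n, .inl v ∈ output G s ↔ A₁ 1 v 0 = 1 := by
    intro v
    have := hD.le_one v
    change s.arr 1 v 0 ≠ 0 ↔ _
    rw [h1 1 (by decide)]
    lia
  have edge : ∀ (u v : Fin n) (huv : h.subgraph.Adj u v),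
      .inr ⟨s(u, v), h.subgraph.adj_sub huv⟩ ∈ output G s ↔ A₁ 1 u 0 ≠ 1 ∧ A₁ 1 v 0 ≠ 1 := by
    intro u v huv
    have hu := hD.le_one u
    have hv := hD.le_one v
    constructor
    · rintro ⟨x, y, hxy, hxy'⟩
      obtain ⟨-, -, -, h3, h4⟩ := (h2 x y).1 hxy'
      rcases Sym2.eq_iff.1 hxy with ⟨rfl, rfl⟩ | ⟨rfl, rfl⟩ <;> lia
    · rintro ⟨h3, h4⟩
      exact ⟨u, v, rfl, (h2 u v).2 ⟨u.2, v.2, huv, by lia, by lia⟩⟩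
  constructor
  · intro v hv
    rw [vertex, hD.unmatched v hv, and_iff_right v.2]
  · rintro e ⟨x, y, hxy, hxy'⟩
    rw [hxy]
    exact ((h2 x y).1 hxy').2.2.1
  · intro u v huv
    rw [vertex, vertex, edge u v huv]
    -- If both ends were flagged, their distinct witnesses would give an augmenting path of length
    -- 3.
    have : ¬ (A₁ 1 u 0 = 1 ∧ A₁ 1 v 0 = 1) := by
      rintro ⟨hu1, hv1⟩
      obtain ⟨z, hz, z', hz', h3, h4, h5⟩ := hD.witness_pair u (h.subgraph.edge_vert huv) v
        (h.subgraph.edge_vert huv.symm) hu1 hv1 huv.adj_sub.ne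
      exact h5 (hM.three hz hz' h3.symm huv h4)
    tauto
  · intro u hu hu1
    exact hD.witness u hu ((vertex u).1 hu1)
  · intro u hu u' hu' hu1 hu1' hne
    exact hD.witness_pair u hu u' hu' ((vertex u).1 hu1) ((vertex u').1 hu1') hne
  · intro z hz hzb hzi
    obtain ⟨u, hu, hu1⟩ := hD.dominated z hz z.2 hzb hzi
    exact ⟨u, hu, (vertex u).2 hu1⟩

end Arrays

end RAM

/-! ### The program -/

namespace RAM

namespace LoopProg

/-- The entry of the vertex `x` in the array `3`. -/
def mate (x : ℕ) : Expr := .read 3 (.var x) (.const 0)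

/-- The entry of `x`, `y` in the adjacency matrix. -/
def adj (x y : ℕ) : Expr := .read 0 (.var x) (.var y)

/-- The entry of the vertex `x` in the array `1`. -/
def flag (x : ℕ) : Expr := .read 1 (.var x) (.const 0)

/-- The entry of the vertex `x` in the array `4`. -/
def seen (x : ℕ) : Expr := .read 4 (.var x) (.const 0)

/-- The successor of the variable `x`. -/
def succ (x : ℕ) : Expr := .add (.var x) (.const 1)

/-- An expression that is `0` if and only if the variables `x` and `y` are different. -/
def same (x y : ℕ) : Expr :=
  .sub (.const 1) (.add (.sub (.var x) (.var y)) (.sub (.var y) (.var x)))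

/-- Match `x` and `y`. -/
def link (x y : ℕ) : LoopProg :=
  seq (store 3 (.var x) (.const 0) (succ y)) (store 3 (.var y) (.const 0) (succ x))

/-- Augment along the path formed by the variables `2`, `3`. -/
def augmentOne : LoopProg :=
  guard [(adj 2 3, .const 1), (mate 2, .const 0), (mate 3, .const 0)] (link 2 3)

/-- Augment along the path formed by the variables `2`, …, `5`. -/
def augmentThree : LoopProg :=
  guard [(adj 2 3, .const 1), (mate 3, succ 4), (adj 4 5, .const 1), (mate 2, .const 0),
    (mate 5, .const 0), (same 2 5, .const 0)] (seq (link 2 3) (link 4 5))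

/-- Augment along the path formed by the variables `2`, …, `7`. -/
def augmentFive : LoopProg :=
  guard [(adj 2 3, .const 1), (mate 3, succ 4), (adj 4 5, .const 1), (mate 5, succ 6),
    (adj 6 7, .const 1), (mate 2, .const 0), (mate 7, .const 0), (same 2 7, .const 0),
    (same 3 5, .const 0)] (seq (seq (link 2 3) (link 4 5)) (link 6 7))

/-- Compute a matching without augmenting paths of length 1, 3 or 5. -/
def matching : LoopProg :=
  forLoop (forLoop (forLoop (forLoop (forLoop (forLoop (forLoop
    (seq (seq augmentOne augmentThree) augmentFive)))))))

/-- Flag the bad vertices. -/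
def markBad : LoopProg :=
  forLoop (forLoop (guard [(mate 1, .const 0), (adj 1 2, .const 1),
    (.sub (.const 1) (mate 2), .const 0),
    (.read 0 (.var 1) (.sub (mate 2) (.const 1)), .const 1)]
    (store 1 (.var 1) (.const 0) (.const 1))))

/-- Flag vertices so that every unmatched vertex is flagged or has a flagged neighbour. -/
def dominate : LoopProg :=
  forLoop (seq (seq
    (forLoop (guard [(adj 1 2, .const 1), (flag 2, .const 1)]
      (store 4 (.var 1) (.const 0) (.const 1))))
    (forLoop (guard [(mate 1, .const 0), (flag 1, .const 0), (adj 1 2, .const 1),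
      (seen 1, .const 0)] (seq (store 1 (.var 2) (.const 0) (.const 1))
        (store 4 (.var 1) (.const 0) (.const 1))))))
    (guard [(mate 1, .const 0), (flag 1, .const 0), (seen 1, .const 0)]
      (store 1 (.var 1) (.const 0) (.const 1))))

/-- Put the matching edges without flagged ends into the cover. -/
def emitEdges : LoopProg :=
  forLoop (forLoop (guard [(mate 1, succ 2), (flag 1, .const 0), (flag 2, .const 0)]
    (store 2 (.var 1) (.var 2) (.const 1))))

/-- The approximation algorithm for the minimum total cover problem. -/
def totalCover : LoopProg := seq (seq (seq matching markBad) dominate) emitEdges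

theorem wellScoped_totalCover : totalCover.WellScoped 1 := by
  simp [totalCover, matching, augmentOne, augmentThree, augmentFive, markBad, dominate, emitEdges,
    WellScoped, guard, link, mate, adj, flag, seen, succ, same, Expr.Below]

/-! ### The effect of the program on the arrays -/

theorem sem_augmentOne (d : ℕ) (ρ : ℕ → ℕ) (A : Arrays) :
    augmentOne.sem d ρ A = Arrays.augmentOne (ρ 2) (ρ 3) A := by
  simp only [Arrays.augmentOne, ite_and]
  rfl

theorem sem_augmentThree (d : ℕ) (ρ : ℕ → ℕ) (A : Arrays) :
    augmentThree.sem d ρ A = Arrays.augmentThree (ρ 2) (ρ 3) (ρ 4) (ρ 5) A := by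
  simp only [Arrays.augmentThree, ite_and]
  rfl

theorem sem_augmentFive (d : ℕ) (ρ : ℕ → ℕ) (A : Arrays) :
    augmentFive.sem d ρ A = Arrays.augmentFive (ρ 2) (ρ 3) (ρ 4) (ρ 5) (ρ 6) (ρ 7) A := by
  simp only [Arrays.augmentFive, ite_and]
  rfl

/-- Variable `1` counts the rounds and is not read by the body, while variables `2` to `7` run
through the candidate paths. -/
theorem sem_matching (ρ : ℕ → ℕ) (A : Arrays) : matching.sem 1 ρ A =
    iter (fun _ => Arrays.augmentRound (ρ 0)) (ρ 0) A := by
  simp [matching, sem, sem_augmentOne, sem_augmentThree, sem_augmentFive,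
    Arrays.augmentRound]

theorem sem_markBad (ρ : ℕ → ℕ) (A : Arrays) : markBad.sem 1 ρ A = Arrays.markBad (ρ 0) A := by
  simp only [Arrays.markBad, ite_and]
  rfl

theorem sem_dominate (ρ : ℕ → ℕ) (A : Arrays) : dominate.sem 1 ρ A = Arrays.dominate (ρ 0) A := by
  simp only [Arrays.dominate, Arrays.flagVertex, Arrays.flagNeighbour, Arrays.checkNeighbours,
    ite_and]
  rfl

theorem sem_emitEdges (ρ : ℕ → ℕ) (A : Arrays) : emitEdges.sem 1 ρ A = Arrays.emitEdges (ρ 0) A := by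
  simp only [Arrays.emitEdges, ite_and]
  rfl

theorem sem_totalCover (ρ : ℕ → ℕ) (A : Arrays) : totalCover.sem 1 ρ A =
    Arrays.emitEdges (ρ 0) (Arrays.dominate (ρ 0) (Arrays.markBad (ρ 0)
      (iter (fun _ => Arrays.augmentRound (ρ 0)) (ρ 0) A))) := by
  simp only [totalCover, sem, sem_matching, sem_markBad, sem_dominate, sem_emitEdges]

end LoopProg

theorem isMatchingOf_input {n : ℕ} (G : SimpleGraph (Fin n)) : Arrays.IsMatchingOf G (input G).arr where
  adj i j := by simp [input]
  mate u v := by simp [input]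
  one := by
    funext i j
    simp [input]
  two := by
    funext i j
    simp [input]
  four := by
    funext i j
    simp [input]

end RAM

/-- At most `n` vertices can be matched, so `n` rounds of augmentation, starting from the empty
matching, end in a fixed point. -/
theorem TotalCover.isPolyTimeApprox_totalCover :
    IsPolyTimeApprox 2 (RAM.LoopProg.totalCover.compile 1) := by
  obtain ⟨B, hB⟩ := RAM.LoopProg.totalCover.exists_runs_compile 1 one_pos
    RAM.LoopProg.wellScoped_totalCover
  refine ⟨B, fun n G => ?_⟩
  obtain ⟨k, s, hr, hk, hs, -⟩ := hB (RAM.input G) (RAM.input G).var fun _ _ => rfl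
  have hn : (RAM.input G).var 0 = n := rfl
  rw [RAM.LoopProg.sem_totalCover, hn] at hs
  rw [hn] at hk
  obtain ⟨hI, hfix⟩ := RAM.Arrays.IsMatchingOf.inflating_augmentRound.iter_fixed
    (fun A _ => RAM.Arrays.IsMatchingOf.size_le n A) (RAM.isMatchingOf_input G)
  have hM := hI.noShortAugmentation hfix
  have hS := hI.isGreedyCover hM hs
  exact ⟨k, s, hr, hk, hS.isTotalCover hM, fun D hD => hS.ncard_le hM hD⟩

theorem mainTheorem1 :
    -- there is a polynomial-time 2-approximation algorithm
    (∃ p : RAM.Prog, TotalCover.IsPolyTimeApprox 2 p) ∧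
    -- for every maximum matching of every finite graph, the greedy procedure never gets stuck, and
    -- its output is always a total cover of size `m + k + t`, at most twice the optimum
    (∀ (V : Type*) [Finite V] (G : SimpleGraph V) (M : G.Subgraph),
      TotalCover.IsMaximumMatching G M →
      (∀ c : TotalCover.Config G, TotalCover.Reachable G M c →
        ∃ (c' : TotalCover.Config G) (S : Set (V ⊕ G.edgeSet)),
          Relation.ReflTransGen (TotalCover.Step G M) c c' ∧ c'.IsFinal S) ∧
      ∀ (c : TotalCover.Config G) (S : Set (V ⊕ G.edgeSet)),
        TotalCover.Reachable G M c → c.IsFinal S →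
        TotalCover.IsTotalCover G S ∧
        S.ncard = M.edgeSet.ncard + (TotalCover.bad G M).ncard + (TotalCover.isolated G).ncard ∧
        ∀ D : Set (V ⊕ G.edgeSet), TotalCover.IsTotalCover G D → S.ncard ≤ 2 * D.ncard) := by
  refine ⟨⟨_, TotalCover.isPolyTimeApprox_totalCover⟩, fun V _ G M hM => ?_⟩
  have hM' := hM.noShortAugmentation
  refine ⟨fun c hc => hc.exists_final hM', fun c S hc hS => ?_⟩
  have h := hc.isGreedyCover hM' hS
  exact ⟨h.isTotalCover hM', h.ncard_eq hM'.isMatching, fun D hD => h.ncard_le hM' hD⟩
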